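/- Stochastic probing with a linear objective. Let $E$ be a finite set; each $e\in E$ is active independently with probability $p_e\in[0,1]$ and has weight $w_e\ge 0$. Let $\mathcal M^{in}_1,\dots,\mathcal M^{in}_{k^{in}}$ and $\mathcal M^{out}_1,\dots,\mathcal M^{out}_{k^{out}}$ be matroids on $E$, with $k^{in}\ge 0$ and $k^{out}\ge 1$. An adaptive (possibly randomized) policy probes distinct elements one by one, learning after each probe whether the probed element is active. At any time let $Q$ be the set of probed elements and $S\subseteq Q$ the set of active ones among them. With probability one, $Q$ must always be independent in every $\mathcal M^{out}_j$ and $S$ in every $\mathcal M^{in}_j$. The value of a policy is $\mathbb E[\sum_{e\in S}w_e]$ for its final set $S$; let $\mathbb E[OPT]$ be the supremum of the values of all policies. For a matroid $\mathcal M$ on $E$ with rank function $r$ let $\mathcal P(\mathcal M)=\{x\in\mathbb R_{\ge0}^E:\sum_{e\in A}x_e\le r(A)\ \forall A\subseteq E\}$. The LP relaxation is $$\max\Big\{\sum_{e} w_ep_ex_e:\ x\in[0,1]^E,\ (p_ex_e)_e\in\mathcal P(\mathcal M^{in}_j)\ \forall j,\ x\in\mathcal P(\mathcal M^{out}_j)\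 \forall j\Big\}.$$ Iterative randomized rounding starts with an optimal solution $x$ of this LP and with $Q=S=\emptyset$. While $x\ne0$, it does the following. 1. For each $j$ it writes $x=\sum_b\beta_b\mathbf 1_{B_b}$ as a convex combination of indicator vectors of independent sets of the contraction $\mathcal M^{out}_j/Q$, and $(p_ex_e)_e$ likewise for each $\mathcal M^{in}_j/S$. For any two sets $B_a,B_b$ of one such combination it fixes a map $\phi_{a,b}:B_a\to B_b\cup\{\bot\}$ with $\phi_{a,b}(e)=e$ for $e\in B_a\cap B_b$, taking each value in $B_b$ at most once, and such that for $e\in B_a\setminus B_b$ the set $B_b+e$ is independent if $\phi_{a,b}(e)=\bot$, and $B_b-\phi_{a,b}(e)+e$ is independent otherwise. 2. It probes an element $\bar e$ drawn with probability $x_{\bar e}/\sum_e x_e$, adds it to $Q$, and, if it is active, also to $S$. 3. Independently for each outer matroid and, if $\bar e$ is active, for each inner matroid, it draws a guiding set $B_a\ni\bar e$ with probability $\beta_a/x_{\bar e}$ (outer) or $\beta_a/(p_{\bar e}x_{\bar e})$ (inner), and removes $\phi_{a,b}(\bar e)$ from each $B_b$ with $\phi_{a,b}(\bar e)\notin\{\bot,\bar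 e\}$. 4. It sets $x_{\bar e}$ to $0$ and decreases the other coordinates of $x$ accordingly: each coordinate stays nonnegative, loses at least what each single matroid's update takes from it, and at most the sum of what these updates take from it. The LP has an optimal solution. For every optimal solution, iterative randomized rounding can be carried out, and, however its choices are made, it is an adaptive policy for the problem with $$\mathbb E\Big[\sum_{e\in S}w_e\Big]\ \ge\ \frac1{k^{in}+k^{out}}\ \mathbb E[OPT].$$ -/

import Mathlib

open scoped Matroid

namespace StochasticProbing

universe u

noncomputable section

/-- The matroid polytope of a matroid `M` on a finite type:
`{x ≥ 0 : ∑_{e ∈ A} x e ≤ r_M(A) for all A ⊆ E}`. -/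
def matroidPolytope {E : Type u} (M : Matroid E) : Set (E → ℝ) :=
  {x | (∀ e, 0 ≤ x e) ∧
    ∀ A : Finset E, ∑ e ∈ A, x e ≤ ((M.eRk (A : Set E)).toNat : ℝ)}

/-- An instance of stochastic probing with a linear objective over the finite universe `E`:
activation probabilities `p`, nonnegative weights `w`, and `kin` inner and `kout` outer matroids
on `E`. -/
structure ProbingInstance (E : Type u) (kin kout : ℕ) where
  p : E → ℝ
  p_nonneg : ∀ e, 0 ≤ p e
  p_le_one : ∀ e, p e ≤ 1
  w : E → ℝ
  w_nonneg : ∀ e, 0 ≤ w e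
  inner : Fin kin → Matroid E
  inner_ground : ∀ j, (inner j).E = Set.univ
  outer : Fin kout → Matroid E
  outer_ground : ∀ j, (outer j).E = Set.univ

/-- A (randomized) adaptive policy, as a decision tree. `probe e π₁ π₀` probes `e` and continues
with `π₁` if `e` is active and with `π₀` if it is not; `random q next` draws `i` with
probability `q i`, using internal randomness only, and continues with `next i`. -/
inductive Policy (E : Type u) : Type (u + 1)
  | done : Policy E
  | probe (e : E) (ifActive ifInactive : Policy E) : Policy E
  | random {ι : Type u} [Fintype ι] (q : ι → ℝ) (next : ι → Policy E) : Policy E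

/-- If `A` is the set of active elements and `S` is the set of elements taken so far, this is the
expectation, over the internal randomness of the policy, of `f` at the final solution. -/
def Policy.valueOn {E : Type u} [DecidableEq E] (f : Finset E → ℝ) (A : Finset E) :
    Policy E → Finset E → ℝ
  | .done, S => f S
  | .probe e π₁ π₀, S =>
      if e ∈ A then π₁.valueOn f A (insert e S) else π₀.valueOn f A S
  | @Policy.random _ ι _ q next, S => ∑ i : ι, q i * (next i).valueOn f A S

namespace ProbingInstance

variable {E : Type u} [Fintype E] [DecidableEq E] {kin kout : ℕ}

/-- The probability that `A` is exactly the set of active elements: every `e` is active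
independently with probability `p e`. -/
def activeProb (I : ProbingInstance E kin kout) (A : Finset E) : ℝ :=
  (∏ e ∈ A, I.p e) * ∏ e ∈ Aᶜ, (1 - I.p e)

/-- The linear objective `S ↦ ∑_{e ∈ S} w e`. -/
def weight (I : ProbingInstance E kin kout) (S : Finset E) : ℝ :=
  ∑ e ∈ S, I.w e

/-- The expected weight of the solution constructed by the policy `π`. -/
def expectedWeight (I : ProbingInstance E kin kout) (π : Policy E) : ℝ :=
  ∑ A : Finset E, I.activeProb A * π.valueOn I.weight A ∅

/-- The policy `π`, started when `Q` is the set of probed elements and `S ⊆ Q` the set of active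
ones among them, respects the constraints: on every branch of positive probability, it never
probes an element twice, the set of probed elements stays independent in all outer matroids, and
the set of elements taken stays independent in all inner matroids. The weights at random nodes
are probability distributions. -/
def Feasible (I : ProbingInstance E kin kout) : Policy E → Finset E → Finset E → Prop
  | .done, _, _ => True
  | .probe e π₁ π₀, Q, S =>
      e ∉ Q ∧ (∀ j, (I.outer j).Indep ((insert e Q : Finset E) : Set E)) ∧
      (0 < I.p e → (∀ j, (I.inner j).Indep ((insert e S : Finset E) : Set E)) ∧
        I.Feasible π₁ (insert e Q) (insert e S)) ∧
      (I.p e < 1 → I.Feasible π₀ (insert e Q) S)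
  | @Policy.random _ ι _ q next, Q, S =>
      (∀ i : ι, 0 ≤ q i) ∧ ∑ i : ι, q i = 1 ∧ ∀ i : ι, 0 < q i → I.Feasible (next i) Q S

/-- `π` is a policy for the stochastic probing problem `I`. -/
def IsPolicy (I : ProbingInstance E kin kout) (π : Policy E) : Prop :=
  I.Feasible π ∅ ∅

/-- The feasible region of the LP relaxation. -/
def lpRegion (I : ProbingInstance E kin kout) : Set (E → ℝ) :=
  {x | (∀ e, 0 ≤ x e ∧ x e ≤ 1) ∧
    (∀ j, (fun e => I.p e * x e) ∈ matroidPolytope (I.inner j)) ∧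
    ∀ j, x ∈ matroidPolytope (I.outer j)}

/-- The objective function of the LP relaxation. -/
def lpValue (I : ProbingInstance E kin kout) (x : E → ℝ) : ℝ :=
  ∑ e, I.w e * (I.p e * x e)

/-- `x` is an optimal solution of the LP relaxation. -/
def IsLPOptimal (I : ProbingInstance E kin kout) (x : E → ℝ) : Prop :=
  x ∈ I.lpRegion ∧ ∀ y ∈ I.lpRegion, I.lpValue y ≤ I.lpValue x

end ProbingInstance

/-- A support of `y` with respect to `M`: a representation of `y` as a convex combination
`∑_b β b • 1_{B b}` of characteristic vectors of independent sets of `M`. -/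
structure ConvexSupport {E : Type u} [DecidableEq E] (M : Matroid E) (y : E → ℝ) where
  ι : Type u
  [fintype : Fintype ι]
  β : ι → ℝ
  B : ι → Finset E
  nonneg : ∀ b, 0 ≤ β b
  sum_eq_one : ∑ b, β b = 1
  indep : ∀ b, M.Indep (B b : Set E)
  eq : ∀ e, y e = ∑ b, if e ∈ B b then β b else 0

attribute [instance] ConvexSupport.fintype

/-- An exchange map `A → B ∪ {⊥}` (with `⊥ = none`) between two independent sets of `M`. Only the
values on `A` are relevant. -/
structure IsExchangeMap {E : Type u} [DecidableEq E] (M : Matroid E) (A B : Finset E)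
    (φ : E → Option E) : Prop where
  mem : ∀ e ∈ A, ∀ f, φ e = some f → f ∈ B
  fix : ∀ e ∈ A, e ∈ B → φ e = some e
  inj : ∀ e ∈ A, ∀ e' ∈ A, ∀ f, φ e = some f → φ e' = some f → e = e'
  indep_of_none : ∀ e ∈ A, e ∉ B → φ e = none → M.Indep ((insert e B : Finset E) : Set E)
  indep_of_some : ∀ e ∈ A, e ∉ B → ∀ f, φ e = some f →
    M.Indep ((insert e (B.erase f) : Finset E) : Set E)

/-- The set which replaces `B` when `e` has been probed and the exchange map from the guiding set
to `B` is `φ`: `B` itself if `φ e = ⊥` or `φ e = e`, and `B - φ e` otherwise. -/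
def updatedSet {E : Type u} [DecidableEq E] (B : Finset E) (φ : E → Option E) (e : E) :
    Finset E :=
  match φ e with
  | none => B
  | some f => if f = e then B else B.erase f

namespace ConvexSupport

variable {E : Type u} [DecidableEq E] {M : Matroid E} {y : E → ℝ}

/-- The probability that `B a` guides the update, when `e` has been probed: `β a / y e` if
`e ∈ B a`, and `0` otherwise. -/
def guideProb (s : ConvexSupport M y) (e : E) (a : s.ι) : ℝ :=
  if e ∈ s.B a then s.β a / y e else 0

/-- The vector represented by the support after the update with probed element `e` and guiding
set `B a`, where `φ a b` is the exchange map from `B a` to `B b`. -/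
def updated (s : ConvexSupport M y) (φ : s.ι → s.ι → E → Option E) (e : E) (a : s.ι) : E → ℝ :=
  fun i => ∑ b, if i ∈ updatedSet (s.B b) (φ a b) e then s.β b else 0

end ConvexSupport

/-- `x'` is a fractional solution obtained from `x` when the element `e` has been probed and the
update of the `j`-th constraint on `x` (`j : Fin k`) alone would give `u j`, and that of the `j`-th
constraint on `p * x` (`j : Fin l`) alone would change `p * x` to `v j`.

The coordinate of `e` becomes `0`. Any other coordinate loses what the single updates take away
from it, but never drops below `0`; where several updates decrease the same coordinate, the
decreases may overlap or add up, in any way. (If `p i = 0`, then the updates of constraints on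
`p * x` do not concern `x i`, and the last sum is `0`.) -/
structure IsCombinedUpdate {E : Type u} (p x : E → ℝ) (e : E) {k l : ℕ}
    (u : Fin k → E → ℝ) (v : Fin l → E → ℝ) (x' : E → ℝ) : Prop where
  probed : x' e = 0
  nonneg : ∀ i, 0 ≤ x' i
  le : ∀ i, x' i ≤ x i
  le_left : ∀ i, i ≠ e → ∀ j, x' i ≤ u j i
  le_right : ∀ i, i ≠ e → ∀ j, p i * x' i ≤ v j i
  loss_le : ∀ i, i ≠ e →
    x i - x' i ≤ ∑ j, (x i - u j i) + ∑ j, (p i * x i - v j i) / p i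

/-- `I.IterativeRounding x Q S π`: the policy `π` is iterative randomized rounding, started with
the fractional solution `x` when the elements of `Q` have been probed and those of `S ⊆ Q` were
active (so that the current matroids are the outer ones contracted by `Q` and the inner ones
contracted by `S`).

It stops if `x = 0`. Otherwise, for every current matroid it takes some support of `x`
(of `p * x` for an inner matroid) with exchange maps between its sets; it probes `e` with
probability `x e / ∑ x`; it draws guiding sets, independently, for all outer matroids and, if `e`
turned out to be active, also for all inner matroids; and it continues with an
updated fractional solution. All these choices may depend on the whole past. Nothing is required
of continuations which have probability zero. -/
inductive ProbingInstance.IterativeRounding {E : Type u} [Fintype E] [DecidableEq E]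
    {kin kout : ℕ} (I : ProbingInstance E kin kout) :
    (E → ℝ) → Finset E → Finset E → Policy E → Prop
  | done (Q S : Finset E) : IterativeRounding I 0 Q S .done
  | step {x : E → ℝ} {Q S : Finset E} (hx : x ≠ 0)
      (out : ∀ j, ConvexSupport (I.outer j ／ (Q : Set E)) x)
      (inn : ∀ j, ConvexSupport (I.inner j ／ (S : Set E)) (fun e => I.p e * x e))
      (φ : ∀ j, (out j).ι → (out j).ι → E → Option E)
      (ψ : ∀ j, (inn j).ι → (inn j).ι → E → Option E)
      (hφ : ∀ j a b, IsExchangeMap (I.outer j ／ (Q : Set E)) ((out j).B a) ((out j).B b) (φ j a b))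
      (hψ : ∀ j a b, IsExchangeMap (I.inner j ／ (S : Set E)) ((inn j).B a) ((inn j).B b) (ψ j a b))
      -- the updated fractional solution and the continuation if `e` is active
      (x₁ : E → (∀ j, (out j).ι) → (∀ j, (inn j).ι) → E → ℝ)
      (π₁ : E → (∀ j, (out j).ι) → (∀ j, (inn j).ι) → Policy E)
      -- the updated fractional solution and the continuation if `e` is not active
      (x₀ : E → (∀ j, (out j).ι) → E → ℝ)
      (π₀ : E → (∀ j, (out j).ι) → Policy E)
      (hx₁ : ∀ e a c, 0 < x e → 0 < I.p e →
        (∀ j, 0 < (out j).guideProb e (a j)) → (∀ j, 0 < (inn j).guideProb e (c j)) →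
        IsCombinedUpdate I.p x e (fun j => (out j).updated (φ j) e (a j))
          (fun j => (inn j).updated (ψ j) e (c j)) (x₁ e a c))
      (hπ₁ : ∀ e a c, 0 < x e → 0 < I.p e →
        (∀ j, 0 < (out j).guideProb e (a j)) → (∀ j, 0 < (inn j).guideProb e (c j)) →
        IterativeRounding I (x₁ e a c) (insert e Q) (insert e S) (π₁ e a c))
      (hx₀ : ∀ e a, 0 < x e → I.p e < 1 → (∀ j, 0 < (out j).guideProb e (a j)) →
        IsCombinedUpdate I.p x e (fun j => (out j).updated (φ j) e (a j))
          (fun j : Fin 0 => j.elim0) (x₀ e a))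
      (hπ₀ : ∀ e a, 0 < x e → I.p e < 1 → (∀ j, 0 < (out j).guideProb e (a j)) →
        IterativeRounding I (x₀ e a) (insert e Q) S (π₀ e a)) :
      IterativeRounding I x Q S
        (.random (fun e => x e / ∑ i, x i) fun e =>
          .probe e
            (.random (fun g : (∀ j, (out j).ι) × (∀ j, (inn j).ι) =>
                (∏ j, (out j).guideProb e (g.1 j)) * ∏ j, (inn j).guideProb e (g.2 j))
              fun g => π₁ e g.1 g.2)
            (.random (fun a : ∀ j, (out j).ι => ∏ j, (out j).guideProb e (a j))
              fun a => π₀ e a))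

end

end StochasticProbing

namespace StochasticProbing

universe u

/-! ### The matroid polytope -/

/-! The LP bounds every policy. Let `x i` be the probability that the policy probes `i`. Activity of
`i` is independent of the decision to probe it, so the policy's value is the LP value of `x`; and
`x` is LP-feasible because on every branch the probed (resp. active) elements of `A` number at most
the rank of `A` in each outer (resp. inner) matroid (`expectedWeight_eq`, `probeProb_mem_lpRegion`).

Rounding is analysed with the LP value `V` as potential. Let `X = ∑ x` and `K = kin + kout`. One
step gains `V / X` in expectation, so it suffices that `V` drops by at most `K * V / X` in
expectation; induction along the decision tree then gives `V ≤ K *` (value of the rounding), which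
is `IterativeRounding.lpValue_le`. The key estimate is `ConvexSupport.expected_loss_le`. In one
support, `i` is removed from `B b` under guiding set `B a` only if some other `e ∈ B a` is mapped to
`i`. This is impossible if `i ∈ B a`, since the exchange map fixes `i` and is injective; otherwise
there is at most one such `e`. Weighting by `β a * β b` bounds the loss by `y i * (1 - y i)`, up to
the factor `1 / X`. Setting the probed coordinate to zero costs a further `x i ^ 2` in coordinate
`i`, which the slack of a single outer matroid pays for.

Rounding can be carried out and is feasible for these reasons: supports exist by Edmonds' theorem
(greedy plus separation), exchange maps by Hall's theorem, and after an update each set of the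
support stays independent when `e` is added, so the new vector lies in the polytope of the
contraction by `e`. -/

lemma Indep.card_inter_le_eRk {E : Type u} [Fintype E] [DecidableEq E] {M : Matroid E}
    {B : Finset E} (hB : M.Indep (B : Set E)) (A : Finset E) :
    (B ∩ A).card ≤ (M.eRk (A : Set E)).toNat := by
  have h1 : M.eRk ((B ∩ A : Finset E) : Set E) = ((B ∩ A : Finset E) : Set E).encard :=
    (hB.subset (by simp)).eRk_eq_encard
  have h2 : M.eRk ((B ∩ A : Finset E) : Set E) ≤ M.eRk (A : Set E) := M.eRk_mono (by simp)
  rw [h1, Set.encard_coe_eq_coe_finsetCard] at h2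
  have h3 : M.eRk (A : Set E) ≠ ⊤ := by
    refine ne_top_of_le_ne_top ?_ (M.eRk_le_encard A)
    rw [Set.encard_coe_eq_coe_finsetCard]; exact ENat.natCast_ne_top _
  have := ENat.toNat_le_toNat h2 h3
  simpa using this

/-- A greedy independent set: it maximizes a nonnegative linear functional on the polytope. -/
lemma exists_indep_forall_polytope_le {E : Type u} [Fintype E] [DecidableEq E] (M : Matroid E)
    (n : ℕ) : ∀ c : E → ℝ, (∀ e, 0 ≤ c e) → (Finset.univ.filter fun e => 0 < c e).card = n →
      ∃ J : Finset E, M.Indep (J : Set E) ∧ (∀ e ∈ J, 0 < c e) ∧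
        ∀ y ∈ matroidPolytope M, ∑ e, c e * y e ≤ ∑ e ∈ J, c e := by
  induction n using Nat.strong_induction_on with
  | _ n ih =>
  intro c hc hn
  set T := Finset.univ.filter fun e => 0 < c e with hT
  have hc0 : ∀ e, e ∉ T → c e = 0 := fun e he =>
    le_antisymm (by simpa [hT] using he) (hc e)
  rcases T.eq_empty_or_nonempty with hTe | hTne
  · refine ⟨∅, by simp, by simp, fun y _ => ?_⟩
    have : ∀ e, c e = 0 := fun e => hc0 e (by simp [hTe])
    simp [this]
  obtain ⟨m, hmT, hm⟩ := T.exists_min_image c hTne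
  have hmpos : 0 < c m := by simpa [hT] using hmT
  -- Peel off the lowest level: `c` is `c'` plus `c m` times the indicator of `T`, and `c'` has
  -- smaller support since it vanishes at `m`.
  set c' : E → ℝ := fun e => if e ∈ T then c e - c m else 0 with hc'
  have hc'0 : ∀ e, 0 ≤ c' e := by
    intro e
    by_cases he : e ∈ T
    · simp [hc', he, hm e he]
    · simp [hc', he]
  have hsub : (Finset.univ.filter fun e => 0 < c' e) ⊆ T.erase m := by
    intro e he
    simp only [Finset.mem_filter, Finset.mem_univ, true_and, hc'] at he
    split_ifs at he with h
    · refine Finset.mem_erase.2 ⟨?_, h⟩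
      rintro rfl
      simp at he
    · exact absurd he (lt_irrefl _)
  obtain ⟨I, hI, hIpos, hImax⟩ := ih _ (by
    rw [← hn]
    exact (Finset.card_le_card hsub).trans_lt (Finset.card_erase_lt_of_mem hmT)) c' hc'0 rfl
  have hIT : I ⊆ T := fun e he =>
    Finset.mem_of_mem_erase (hsub (by simpa using hIpos e he))
  -- Extending the optimal set for `c'` to a basis of `T` also makes the bound `∑ e ∈ T, y e ≤ r(T)`
  -- tight.
  obtain ⟨J', hJ', hIJ'⟩ := hI.subset_isBasis'_of_subset (X := (T : Set E)) (by exact_mod_cast hIT)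
  obtain ⟨J, rfl⟩ : ∃ J : Finset E, (J : Set E) = J' := ⟨J'.toFinite.toFinset, by simp⟩
  have hJT : J ⊆ T := by exact_mod_cast hJ'.subset
  have hIJ : I ⊆ J := by exact_mod_cast hIJ'
  refine ⟨J, hJ'.indep, fun e he => by simpa [hT] using hJT he, fun y hy => ?_⟩
  have hcard : ((M.eRk (T : Set E)).toNat : ℝ) = J.card := by
    rw [hJ'.eRk_eq_encard, Set.encard_coe_eq_coe_finsetCard]; simp
  calc ∑ e, c e * y e = ∑ e, c' e * y e + c m * ∑ e ∈ T, y e := by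
        rw [← Finset.sum_filter_add_sum_filter_not Finset.univ (· ∈ T) (fun e => c e * y e),
          ← Finset.sum_filter_add_sum_filter_not Finset.univ (· ∈ T) (fun e => c' e * y e),
          Finset.filter_univ_mem, Finset.mul_sum]
        rw [Finset.sum_eq_zero (s := Finset.univ.filter (· ∉ T)) (f := fun e => c e * y e),
          Finset.sum_eq_zero (s := Finset.univ.filter (· ∉ T)) (f := fun e => c' e * y e),
          add_zero, add_zero, ← Finset.sum_add_distrib]
        · refine Finset.sum_congr rfl fun e he => ?_
          simp only [hc', he, if_true]; ring
        · intro e he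
          have : e ∉ T := by simpa using he
          simp [hc', this]
        · intro e he
          simp [hc0 e (by simpa using he)]
    _ ≤ ∑ e ∈ I, c' e + c m * J.card := by
        have := hy.2 T
        rw [hcard] at this
        gcongr
        exact hImax y hy
    _ ≤ ∑ e ∈ J, c' e + c m * J.card := by
        gcongr
        exact fun e _ _ => hc'0 e
    _ = ∑ e ∈ J, c e := by
        rw [Finset.card_eq_sum_ones, Nat.cast_sum, Finset.mul_sum, ← Finset.sum_add_distrib]
        refine Finset.sum_congr rfl fun e he => ?_
        simp [hc', hJT he]

/-- The characteristic vector of a finite set. -/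
def charVec {E : Type u} [DecidableEq E] (B : Finset E) : E → ℝ := fun e => if e ∈ B then 1 else 0

/-- Edmonds' theorem: the matroid polytope is the convex hull of the characteristic vectors of
the independent sets. -/
lemma matroidPolytope_subset_convexHull {E : Type u} [Fintype E] [DecidableEq E] (M : Matroid E) :
    matroidPolytope M ⊆
      convexHull ℝ (Set.range fun I : {I : Finset E // M.Indep (I : Set E)} => charVec I.1) := by
  classical
  intro y hy
  by_contra hnot
  obtain ⟨f, r, hf, hr⟩ := geometric_hahn_banach_closed_point (convex_convexHull ℝ _)
    ((Set.finite_range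
      fun I : {I : Finset E // M.Indep (I : Set E)} => charVec I.1).isClosed_convexHull ℝ) hnot
  set d : E → ℝ := fun e => f (Pi.single e 1) with hd
  have hfd : ∀ z : E → ℝ, f z = ∑ e, d e * z e := by
    intro z
    have := LinearMap.pi_apply_eq_sum_univ (f : (E → ℝ) →ₗ[ℝ] ℝ) z
    simp only [ContinuousLinearMap.coe_coe] at this
    rw [this]
    refine Finset.sum_congr rfl fun e _ => ?_
    rw [smul_eq_mul, mul_comm, hd]
    congr 2
    ext i
    simp [Pi.single_apply, eq_comm]
  -- Since `y ≥ 0`, passing to the positive part only increases the functional at `y`; the greedy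
  -- set uses only elements with `d e > 0`, where nothing changes. So an independent set does at
  -- least as well as `y`, contradicting separation.
  obtain ⟨J, hJ, hJpos, hJmax⟩ := exists_indep_forall_polytope_le M _ (fun e => max (d e) 0)
    (fun e => le_max_right _ _) rfl
  have h1 := hJmax y hy
  have h2 : ∑ e, d e * y e ≤ ∑ e, max (d e) 0 * y e :=
    Finset.sum_le_sum fun e _ => mul_le_mul_of_nonneg_right (le_max_left _ _) (hy.1 e)
  have h3 : ∑ e ∈ J, max (d e) 0 = f (charVec J) := by
    rw [hfd, ← Finset.sum_filter_add_sum_filter_not Finset.univ (· ∈ J)]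
    rw [Finset.filter_univ_mem, Finset.sum_eq_zero (s := Finset.univ.filter (· ∉ J)), add_zero]
    · refine Finset.sum_congr rfl fun e he => ?_
      have : 0 < d e := by simpa using hJpos e he
      simp [charVec, he, this.le]
    · intro e he
      have : e ∉ J := by simpa using he
      simp [charVec, this]
  have h4 := hf (charVec J) (subset_convexHull ℝ _ ⟨⟨J, hJ⟩, rfl⟩)
  rw [hfd y] at hr
  linarith

lemma nonempty_convexSupport {E : Type u} [Fintype E] [DecidableEq E] {M : Matroid E} {y : E → ℝ}
    (hy : y ∈ matroidPolytope M) : Nonempty (ConvexSupport M y) := by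
  classical
  have h := matroidPolytope_subset_convexHull M hy
  rw [convexHull_range_eq_exists_affineCombination] at h
  obtain ⟨s, w, hw, hw1, rfl⟩ := h
  rw [Finset.affineCombination_eq_linear_combination _ _ _ hw1]
  -- Index by all independent sets, with weight `0` outside the finite family given by the convex
  -- hull.
  refine ⟨{ ι := {I : Finset E // M.Indep (I : Set E)}
            β := fun I => if I ∈ s then w I else 0
            B := fun I => I.1
            nonneg := fun I => by split_ifs with h <;> simp [hw _, *]
            sum_eq_one := by simpa [Finset.sum_ite_mem] using hw1
            indep := fun I => I.2
            eq := fun e => ?_ }⟩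
  rw [Finset.sum_apply, ← Finset.sum_filter_add_sum_filter_not Finset.univ (· ∈ s),
    Finset.filter_univ_mem, Finset.sum_eq_zero (s := Finset.univ.filter (· ∉ s)), add_zero]
  · refine Finset.sum_congr rfl fun I hI => ?_
    simp [charVec, hI]
  · intro I hI
    have : I ∉ s := by simpa using hI
    simp [this]

/-! ### Exchange maps -/

lemma exists_isExchangeMap {E : Type u} [Fintype E] [DecidableEq E] {M : Matroid E}
    {A B : Finset E} (hA : M.Indep (A : Set E)) (hB : M.Indep (B : Set E)) :
    ∃ φ, IsExchangeMap M A B φ := by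
  classical
  -- Only the elements of `A \ B` spanned by `B` need a partner; the others of `A \ B` go to `none`.
  -- Partners are sought outside `A`, so they cannot collide with the fixed points in `A ∩ B`.
  let N : E → Finset E := fun e => {f ∈ B \ A | M.Indep ((insert e (B.erase f) : Finset E) : Set E)}
  let D := {e : E // e ∈ A ∧ e ∉ B ∧ e ∈ M.closure (B : Set E)}
  have hall : ∀ X : Finset D, X.card ≤ (X.biUnion fun e => N e.1).card := by
    intro X
    set Y : Finset E := X.map (Function.Embedding.subtype _) with hY
    set Z : Finset E := X.biUnion fun e => N e.1 with hZ
    have hYA : Y ∪ (A ∩ B) ⊆ A := by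
      intro e he
      simp only [Finset.mem_union, hY, Finset.mem_map, Function.Embedding.subtype_apply,
        Finset.mem_inter] at he
      rcases he with ⟨a, _, rfl⟩ | h
      · exact a.2.1
      · exact h.1
    have hind : M.Indep ((Y ∪ (A ∩ B) : Finset E) : Set E) := hA.subset (by exact_mod_cast hYA)
    have hdisj : Disjoint Y (A ∩ B) := by
      rw [Finset.disjoint_left]
      intro e he
      simp only [hY, Finset.mem_map, Function.Embedding.subtype_apply] at he
      obtain ⟨a, _, rfl⟩ := he
      simp [a.2.2.1]
    have hground : ((Z ∪ (A ∩ B) : Finset E) : Set E) ⊆ M.E := by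
      refine subset_trans ?_ hB.subset_ground
      intro e he
      simp only [Finset.coe_union, Set.mem_union, Finset.mem_coe, hZ, Finset.mem_biUnion, N,
        Finset.mem_filter, Finset.mem_sdiff, Finset.mem_inter] at he
      rcases he with ⟨a, _, h, _⟩ | h
      · exact h.1
      · exact h.2
    -- Hall's condition is a rank count. The fundamental circuit of `e` in `B` consists of `e`,
    -- elements of `N e`, and elements of `A ∩ B`, so the independent set `Y ∪ (A ∩ B)` is spanned
    -- by `Z ∪ (A ∩ B)`.
    have hcl : ((Y ∪ (A ∩ B) : Finset E) : Set E) ⊆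
        M.closure ((Z ∪ (A ∩ B) : Finset E) : Set E) := by
      intro e he
      rw [Finset.mem_coe, Finset.mem_union] at he
      rcases he with he | he
      · simp only [hY, Finset.mem_map, Function.Embedding.subtype_apply] at he
        obtain ⟨a, haX, rfl⟩ := he
        obtain ⟨haA, haB, hacl⟩ := a.2
        have hmem := (hB.fundCircuit_isCircuit hacl haB).mem_closure_sdiff_singleton_of_mem
          (M.mem_fundCircuit a.1 B)
        refine M.closure_subset_closure ?_ hmem
        rintro f ⟨hf, hfa⟩
        have hfB : f ∈ B := by
          have := M.fundCircuit_subset_insert a.1 B hf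
          simpa [show f ≠ a.1 from hfa] using this
        rw [hB.mem_fundCircuit_iff hacl haB] at hf
        by_cases hfA : f ∈ A
        · simp [hfA, hfB]
        · have : f ∈ Z := by
            rw [hZ, Finset.mem_biUnion]
            refine ⟨a, haX, ?_⟩
            simp only [N, Finset.mem_filter, Finset.mem_sdiff]
            refine ⟨⟨hfB, hfA⟩, ?_⟩
            convert hf using 1
            ext i
            simp only [Finset.coe_insert, Finset.coe_erase, Set.mem_insert_iff, Set.mem_sdiff,
              Finset.mem_coe, Set.mem_singleton_iff]
            constructor
            · rintro (rfl | h)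
              · exact ⟨Or.inl rfl, fun h => hfa h.symm⟩
              · exact ⟨Or.inr h.1, h.2⟩
            · rintro ⟨rfl | h, h'⟩
              · exact Or.inl rfl
              · exact Or.inr ⟨h, h'⟩
          simp [this]
      · refine M.subset_closure _ hground ?_
        simp only [Finset.coe_union, Set.mem_union, Finset.mem_coe]
        exact Or.inr he
    have hle : M.eRk ((Y ∪ (A ∩ B) : Finset E) : Set E) ≤
        M.eRk ((Z ∪ (A ∩ B) : Finset E) : Set E) := by
      rw [← M.eRk_closure_eq ((Z ∪ (A ∩ B) : Finset E) : Set E)]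
      exact M.eRk_mono hcl
    rw [hind.eRk_eq_encard] at hle
    have hle2 := hle.trans (M.eRk_le_encard _)
    rw [Set.encard_coe_eq_coe_finsetCard, Set.encard_coe_eq_coe_finsetCard, Nat.cast_le,
      Finset.card_union_of_disjoint hdisj] at hle2
    have := Finset.card_union_le Z (A ∩ B)
    have hYX : Y.card = X.card := by simp [hY]
    omega
  obtain ⟨g, hginj, hg⟩ := (Finset.all_card_le_biUnion_card_iff_exists_injective _).1 hall
  simp only [N, Finset.mem_filter, Finset.mem_sdiff] at hg
  refine ⟨fun e => if e ∈ B then some e else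
    if h : e ∈ A ∧ e ∉ B ∧ e ∈ M.closure (B : Set E) then some (g ⟨e, h⟩) else none, ?_, ?_, ?_, ?_, ?_⟩
  · intro e _ f hf
    split_ifs at hf with h1 h2
    · cases hf; exact h1
    · cases hf; exact (hg _).1.1
  · intro e _ he
    simp [he]
  · intro e he e' he' f hf hf'
    split_ifs at hf hf' with h1 h2 h3 h4 h5
    · cases hf; cases hf'; rfl
    · cases hf; cases hf'; exact absurd he (hg _).1.2
    · cases hf; cases hf'; exact absurd he' (hg _).1.2
    · have := hf.trans hf'.symm
      exact congrArg Subtype.val (hginj (Option.some.inj this))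
  · intro e heA heB hf
    split_ifs at hf with h2
    have h3 : e ∉ M.closure (B : Set E) := fun h => h2 ⟨heA, heB, h⟩
    rw [Finset.coe_insert, hB.insert_indep_iff_of_notMem (by simpa using heB)]
    exact ⟨hA.subset_ground (by simpa using heA), h3⟩
  · intro e heA heB f hf
    split_ifs at hf with h2
    cases hf
    exact (hg _).2

/-! ### Convex supports -/

lemma mem_matroidPolytope_of_le {E : Type u} {M : Matroid E} {x y : E → ℝ} (hy : y ∈ matroidPolytope M)
    (hx : ∀ e, 0 ≤ x e) (hxy : ∀ e, x e ≤ y e) : x ∈ matroidPolytope M :=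
  ⟨hx, fun A => (Finset.sum_le_sum fun e _ => hxy e).trans (hy.2 A)⟩

lemma sum_indicator_eq {E : Type u} [DecidableEq E] {ι : Type*} [Fintype ι] (β : ι → ℝ) (B : ι → Finset E) (A : Finset E) :
    ∑ e ∈ A, ∑ b, (if e ∈ B b then β b else 0) = ∑ b, β b * (B b ∩ A).card := by
  rw [Finset.sum_comm]
  refine Finset.sum_congr rfl fun b _ => ?_
  rw [← Finset.sum_filter, Finset.sum_const, nsmul_eq_mul, mul_comm, Finset.filter_mem_eq_inter,
    Finset.inter_comm]

/-- A nonnegative combination of independent sets of total weight `1` is in the polytope. -/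
lemma mem_matroidPolytope_of_sum {E : Type u} [Fintype E] [DecidableEq E]
    {M : Matroid E} {ι : Type*} [Fintype ι] {β : ι → ℝ}
    {B : ι → Finset E} (h0 : ∀ b, 0 ≤ β b) (h1 : ∑ b, β b = 1)
    (hB : ∀ b, 0 < β b → M.Indep (B b : Set E)) :
    (fun e => ∑ b, if e ∈ B b then β b else 0) ∈ matroidPolytope M := by
  refine ⟨fun e => Finset.sum_nonneg fun b _ => ?_, fun A => ?_⟩
  · split_ifs
    exacts [h0 b, le_rfl]
  · rw [sum_indicator_eq]
    calc ∑ b, β b * ((B b ∩ A).card : ℝ) ≤ ∑ b, β b * ((M.eRk (A : Set E)).toNat : ℝ) := by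
          refine Finset.sum_le_sum fun b _ => ?_
          rcases (h0 b).eq_or_lt with h | h
          · simp [← h]
          · exact mul_le_mul_of_nonneg_left
              (by exact_mod_cast Indep.card_inter_le_eRk (hB b h) A) h.le
      _ = _ := by rw [← Finset.sum_mul, h1, one_mul]

lemma IsExchangeMap.indep_insert_updatedSet {E : Type u} [DecidableEq E] {M : Matroid E}
    {A B : Finset E} {φ : E → Option E} (h : IsExchangeMap M A B φ) (hB : M.Indep (B : Set E))
    {e : E} (he : e ∈ A) : M.Indep ((insert e (updatedSet B φ e) : Finset E) : Set E) := by
  unfold updatedSet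
  by_cases heB : e ∈ B
  · simpa [h.fix e he heB, heB] using hB
  · split
    · exact h.indep_of_none e he heB ‹_›
    · rename_i f hf
      have hfe : f ≠ e := by
        rintro rfl
        exact heB (h.mem _ he _ hf)
      rw [if_neg hfe]
      exact h.indep_of_some e he heB f hf

lemma mem_updatedSet_iff {E : Type u} [DecidableEq E] {B : Finset E} {φ : E → Option E} {e i : E} :
    i ∈ updatedSet B φ e ↔ i ∈ B ∧ ¬ (φ e = some i ∧ i ≠ e) := by
  unfold updatedSet
  split
  · simp [*]
  · rename_i f hf
    split_ifs with h
    · subst h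
      simp only [hf, Option.some.injEq]
      refine ⟨fun h => ⟨h, ?_⟩, fun h => h.1⟩
      rintro ⟨rfl, h⟩
      exact h rfl
    · simp only [Finset.mem_erase, hf, Option.some.injEq]
      constructor
      · rintro ⟨h1, h2⟩
        exact ⟨h2, fun h3 => h1 h3.1.symm⟩
      · rintro ⟨h1, h2⟩
        refine ⟨?_, h1⟩
        rintro rfl
        exact h2 ⟨rfl, h⟩

namespace ConvexSupport

variable {E : Type u} [DecidableEq E] {M : Matroid E} {y : E → ℝ}

lemma nonneg_vec (s : ConvexSupport M y) (e : E) : 0 ≤ y e := by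
  rw [s.eq e]
  refine Finset.sum_nonneg fun b _ => ?_
  split_ifs
  exacts [s.nonneg b, le_rfl]

lemma guideProb_nonneg (s : ConvexSupport M y) (e : E) (a : s.ι) : 0 ≤ s.guideProb e a := by
  unfold guideProb
  split_ifs
  exacts [div_nonneg (s.nonneg a) (s.nonneg_vec e), le_rfl]

lemma mem_of_guideProb_pos (s : ConvexSupport M y) {e : E} {a : s.ι} (h : 0 < s.guideProb e a) :
    e ∈ s.B a := by
  unfold guideProb at h
  split_ifs at h with h1
  · exact h1
  · exact absurd h (lt_irrefl _)

lemma sum_guideProb (s : ConvexSupport M y) {e : E} (he : 0 < y e) : ∑ a, s.guideProb e a = 1 := by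
  have : ∀ a, s.guideProb e a = (if e ∈ s.B a then s.β a else 0) / y e := by
    intro a; unfold guideProb; split_ifs <;> simp
  simp_rw [this]
  rw [← Finset.sum_div, ← s.eq e, div_self he.ne']

/-- The cross-multiplied form survives `y e = 0`: then every set containing `e` has weight `0`. -/
lemma mul_guideProb (s : ConvexSupport M y) (e : E) (a : s.ι) :
    y e * s.guideProb e a = if e ∈ s.B a then s.β a else 0 := by
  unfold guideProb
  split_ifs with h
  · rcases (s.nonneg_vec e).eq_or_lt with h0 | h0
    · rw [← h0, zero_mul]
      have h1 := s.eq e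
      rw [← h0] at h1
      have h2 := (Finset.sum_eq_zero_iff_of_nonneg (fun b _ => by
        split_ifs
        exacts [s.nonneg b, le_rfl])).1 h1.symm a (Finset.mem_univ _)
      rw [if_pos h] at h2
      exact h2.symm
    · field_simp
  · simp

lemma exists_mem (s : ConvexSupport M y) {e : E} (he : 0 < y e) : ∃ b, e ∈ s.B b := by
  by_contra! h
  rw [s.eq e] at he
  simp [h] at he

lemma indep_singleton (s : ConvexSupport M y) {e : E} (he : 0 < y e) : M.Indep {e} := by
  obtain ⟨b, hb⟩ := s.exists_mem he
  exact (s.indep b).subset (by simpa using hb)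

lemma updated_nonneg (s : ConvexSupport M y) (φ : s.ι → s.ι → E → Option E) (e : E) (a : s.ι)
    (i : E) : 0 ≤ s.updated φ e a i := by
  refine Finset.sum_nonneg fun b _ => ?_
  split_ifs
  exacts [s.nonneg b, le_rfl]

/-- The loss of the `i`-th coordinate in an update. -/
lemma sub_updated (s : ConvexSupport M y) (φ : s.ι → s.ι → E → Option E) (e : E) (a : s.ι)
    (i : E) : y i - s.updated φ e a i =
      ∑ b, if i ∈ s.B b ∧ φ a b e = some i ∧ i ≠ e then s.β b else 0 := by
  rw [s.eq i, updated, ← Finset.sum_sub_distrib]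
  refine Finset.sum_congr rfl fun b _ => ?_
  simp only [mem_updatedSet_iff]
  by_cases h1 : i ∈ s.B b <;> by_cases h2 : (φ a b e = some i ∧ i ≠ e)
  · simp [h1, h2.1, h2.2]
  · simp only [h1, h2, true_and]; simp
  · simp [h1]
  · simp [h1]

lemma updated_le (s : ConvexSupport M y) (φ : s.ι → s.ι → E → Option E) (e : E) (a : s.ι)
    (i : E) : s.updated φ e a i ≤ y i := by
  rw [← sub_nonneg, sub_updated]
  refine Finset.sum_nonneg fun b _ => ?_
  split_ifs
  exacts [s.nonneg b, le_rfl]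

/-- After an update, the represented vector without the probed coordinate is in the polytope of
the contraction. -/
lemma mem_matroidPolytope_contract [Fintype E] (s : ConvexSupport M y)
    {φ : s.ι → s.ι → E → Option E} {e : E} {a : s.ι} (he : e ∈ s.B a)
    (hφ : ∀ b, IsExchangeMap M (s.B a) (s.B b) (φ a b)) {x : E → ℝ} (hx : ∀ i, 0 ≤ x i)
    (hxe : x e = 0) (hxu : ∀ i, i ≠ e → x i ≤ s.updated φ e a i) :
    x ∈ matroidPolytope (M ／ {e}) := by
  have heM : M.Indep {e} := (s.indep a).subset (by simpa using he)
  -- The weights are kept. Each updated set with `e` deleted is independent in the contraction,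
  -- because adding `e` back is independent in `M`.
  refine mem_matroidPolytope_of_le (mem_matroidPolytope_of_sum (M := M ／ {e}) (β := s.β)
    (B := fun b => (updatedSet (s.B b) (φ a b) e).erase e) s.nonneg s.sum_eq_one ?_) hx ?_
  · intro b _
    rw [heM.contract_indep_iff]
    refine ⟨by simp, ((hφ b).indep_insert_updatedSet (s.indep b) he).subset ?_⟩
    intro i
    simp only [Finset.coe_erase, Set.mem_union, Set.mem_sdiff, Finset.mem_coe,
      Set.mem_singleton_iff, Finset.coe_insert, Set.mem_insert_iff]
    tauto
  · intro i
    by_cases hi : i = e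
    · subst hi
      simp [hxe]
    · simpa [updated, hi] using hxu i hi

/-- The expected loss of the `i`-th coordinate while another element is probed. -/
lemma expected_loss_le [Fintype E] (s : ConvexSupport M y) {φ : s.ι → s.ι → E → Option E}
    (hφ : ∀ a b, IsExchangeMap M (s.B a) (s.B b) (φ a b)) (i : E) :
    ∑ e, y e * ∑ a, s.guideProb e a * (if i = e then 0 else y i - s.updated φ e a i) ≤
      y i * (1 - y i) := by
  have h1 : ∀ a, ∑ e, (if e ∈ s.B a then s.β a else 0) *
      (if i = e then 0 else y i - s.updated φ e a i) ≤
      ∑ b, if i ∈ s.B a then 0 else if i ∈ s.B b then s.β a * s.β b else 0 := by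
    intro a
    have h2 : ∀ e, (if e ∈ s.B a then s.β a else 0) *
        (if i = e then 0 else y i - s.updated φ e a i) =
        ∑ b, if e ∈ s.B a ∧ i ∈ s.B b ∧ φ a b e = some i ∧ i ≠ e then s.β a * s.β b else 0 := by
      intro e
      rw [sub_updated]
      by_cases hie : i = e
      · simp [hie]
      by_cases hea : e ∈ s.B a
      · simp only [hea, if_true, hie, if_false, true_and]
        rw [Finset.mul_sum]
        simp only [mul_ite, mul_zero]
      · simp [hea]
    simp_rw [h2]
    rw [Finset.sum_comm]
    refine Finset.sum_le_sum fun b _ => ?_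
    have hβ : 0 ≤ s.β a * s.β b := mul_nonneg (s.nonneg a) (s.nonneg b)
    rw [← Finset.sum_filter]
    by_cases hib : i ∈ s.B b
    -- If `i ∈ B a`, the map already sends `i` to itself, so no other element is sent there;
    -- otherwise injectivity leaves at most one preimage.
    · by_cases hia : i ∈ s.B a
      · rw [Finset.filter_false_of_mem]
        · simp [hia]
        · rintro e - ⟨hea, -, hei, hne⟩
          exact hne ((hφ a b).inj i hia e hea i ((hφ a b).fix i hia hib) hei)
      · simp only [hia, hib, if_true, if_false]
        rw [Finset.sum_const, nsmul_eq_mul]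
        refine mul_le_of_le_one_left hβ ?_
        have : (Finset.univ.filter fun e => e ∈ s.B a ∧ True ∧ φ a b e = some i ∧ i ≠ e).card ≤ 1 := by
          refine Finset.card_le_one.2 fun e he e' he' => ?_
          simp only [Finset.mem_filter, Finset.mem_univ, true_and] at he he'
          exact (hφ a b).inj e he.1 e' he'.1 i he.2.1 he'.2.1
        exact_mod_cast this
    · simp [hib]
  calc ∑ e, y e * ∑ a, s.guideProb e a * (if i = e then 0 else y i - s.updated φ e a i)
      = ∑ a, ∑ e, (if e ∈ s.B a then s.β a else 0) *
          (if i = e then 0 else y i - s.updated φ e a i) := by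
        rw [Finset.sum_comm]
        refine Finset.sum_congr rfl fun e _ => ?_
        rw [Finset.mul_sum]
        refine Finset.sum_congr rfl fun a _ => ?_
        rw [← mul_assoc, mul_guideProb]
    _ ≤ ∑ a, ∑ b, if i ∈ s.B a then 0 else if i ∈ s.B b then s.β a * s.β b else 0 :=
        Finset.sum_le_sum fun a _ => h1 a
    _ = ∑ a, (if i ∈ s.B a then 0 else s.β a) * y i := by
        refine Finset.sum_congr rfl fun a _ => ?_
        rw [s.eq i, Finset.mul_sum]
        refine Finset.sum_congr rfl fun b _ => ?_
        split_ifs <;> simp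
    _ = (1 - y i) * y i := by
        rw [← Finset.sum_mul]
        congr 1
        nth_rw 1 [s.eq i]
        rw [← s.sum_eq_one, ← Finset.sum_sub_distrib]
        refine Finset.sum_congr rfl fun a _ => ?_
        split_ifs <;> simp
    _ = y i * (1 - y i) := mul_comm _ _

end ConvexSupport

/-! ### The LP relaxation and combined updates -/

lemma isClosed_matroidPolytope {E : Type u} (M : Matroid E) : IsClosed (matroidPolytope M) := by
  have : matroidPolytope M = (⋂ e, {x : E → ℝ | 0 ≤ x e}) ∩
      ⋂ A : Finset E, {x : E → ℝ | ∑ e ∈ A, x e ≤ ((M.eRk (A : Set E)).toNat : ℝ)} := by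
    ext x
    simp [matroidPolytope]
  rw [this]
  exact (isClosed_iInter fun e => isClosed_le continuous_const (continuous_apply e)).inter
    (isClosed_iInter fun A => isClosed_le
      (continuous_finsetSum A fun e _ => continuous_apply e) continuous_const)

lemma exists_isLPOptimal {E : Type u} [Fintype E] [DecidableEq E] {kin kout : ℕ}
    (I : ProbingInstance E kin kout) : ∃ x, I.IsLPOptimal x := by
  have hcl : IsClosed I.lpRegion := by
    have : I.lpRegion = (Set.pi Set.univ fun _ : E => Set.Icc (0 : ℝ) 1) ∩
        ((⋂ j, (fun (x : E → ℝ) e => I.p e * x e) ⁻¹' matroidPolytope (I.inner j)) ∩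
          ⋂ j, matroidPolytope (I.outer j)) := by
      ext x
      simp only [ProbingInstance.lpRegion, Set.mem_ofPred_eq, Set.mem_inter_iff, Set.mem_pi,
        Set.mem_univ, true_implies, Set.mem_Icc, Set.mem_iInter, Set.mem_preimage]
    rw [this]
    refine (isClosed_set_pi fun _ _ => isClosed_Icc).inter
      ((isClosed_iInter fun j => (isClosed_matroidPolytope _).preimage ?_).inter
        (isClosed_iInter fun j => isClosed_matroidPolytope _))
    exact continuous_pi fun e => continuous_const.mul (continuous_apply e)
  have hcomp : IsCompact I.lpRegion := by
    refine (isCompact_univ_pi fun _ : E => isCompact_Icc (a := (0 : ℝ)) (b := 1)).of_isClosed_subset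
      hcl ?_
    intro x hx
    exact fun e _ => hx.1 e
  have hne : I.lpRegion.Nonempty := by
    refine ⟨0, ?_, ?_, ?_⟩ <;> simp [matroidPolytope]
  have hcont : Continuous I.lpValue := by
    unfold ProbingInstance.lpValue
    exact continuous_finsetSum _ fun e _ =>
      continuous_const.mul (continuous_const.mul (continuous_apply e))
  obtain ⟨x, hx, hmax⟩ := hcomp.exists_isMaxOn hne hcont.continuousOn
  exact ⟨x, hx, fun y hy => hmax hy⟩

/-- The update in which the decreases of all constraints add up. -/
noncomputable def additiveUpdate {E : Type u} [DecidableEq E] (p x : E → ℝ) (e : E) {k l : ℕ}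
    (u : Fin k → E → ℝ) (v : Fin l → E → ℝ) : E → ℝ := fun i =>
  if i = e then 0 else
    max 0 (x i - (∑ j, (x i - u j i) + ∑ j, (p i * x i - v j i) / p i))

lemma isCombinedUpdate_additiveUpdate {E : Type u} [DecidableEq E] {p x : E → ℝ} {e : E} {k l : ℕ}
    {u : Fin k → E → ℝ} {v : Fin l → E → ℝ} (hp : ∀ i, 0 ≤ p i) (hx : ∀ i, 0 ≤ x i)
    (hu0 : ∀ j i, 0 ≤ u j i) (hu : ∀ j i, u j i ≤ x i) (hv0 : ∀ j i, 0 ≤ v j i)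
    (hv : ∀ j i, v j i ≤ p i * x i) :
    IsCombinedUpdate p x e u v (additiveUpdate p x e u v) := by
  have hA : ∀ i j, 0 ≤ x i - u j i := fun i j => sub_nonneg.2 (hu j i)
  have hB : ∀ i j, 0 ≤ (p i * x i - v j i) / p i :=
    fun i j => div_nonneg (sub_nonneg.2 (hv j i)) (hp i)
  have hAs : ∀ i, 0 ≤ ∑ j, (x i - u j i) := fun i => Finset.sum_nonneg fun j _ => hA i j
  have hBs : ∀ i, 0 ≤ ∑ j, (p i * x i - v j i) / p i := fun i => Finset.sum_nonneg fun j _ => hB i j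
  refine ⟨by simp [additiveUpdate], fun i => ?_, fun i => ?_, fun i hi j => ?_, fun i hi j => ?_,
    fun i hi => ?_⟩
  · unfold additiveUpdate
    split_ifs
    exacts [le_rfl, le_max_left _ _]
  · unfold additiveUpdate
    split_ifs
    · exact hx i
    · exact max_le (hx i) (by linarith [hAs i, hBs i])
  · simp only [additiveUpdate, hi, if_false]
    have := Finset.single_le_sum (f := fun j => x i - u j i) (fun j _ => hA i j) (Finset.mem_univ j)
    exact max_le (hu0 j i) (by linarith [hBs i])
  · simp only [additiveUpdate, hi, if_false]
    rcases (hp i).eq_or_lt with h | h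
    · rw [← h, zero_mul]; exact hv0 j i
    · have h1 := Finset.single_le_sum (f := fun j => (p i * x i - v j i) / p i)
        (fun j _ => hB i j) (Finset.mem_univ j)
      have h2 : p i * ((p i * x i - v j i) / p i) = p i * x i - v j i := by field_simp
      rw [mul_max_of_nonneg _ _ (hp i), mul_zero]
      refine max_le (hv0 j i) ?_
      have h3 : p i * (x i - (∑ j, (x i - u j i) + ∑ j, (p i * x i - v j i) / p i)) ≤
          p i * (x i - (p i * x i - v j i) / p i) :=
        mul_le_mul_of_nonneg_left (by linarith [hAs i]) (hp i)
      rw [mul_sub _ _ (_ / _), h2] at h3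
      linarith
  · simp only [additiveUpdate, hi, if_false]
    linarith [le_max_right 0 (x i - (∑ j, (x i - u j i) + ∑ j, (p i * x i - v j i) / p i))]

/-- The loss of the linear functional `c` outside of `e` when `y` is replaced by `u`. -/
noncomputable def offLoss {E : Type u} [Fintype E] [DecidableEq E] (c : E → ℝ) (e : E) (y u : E → ℝ) : ℝ :=
  ∑ i, c i * (if i = e then 0 else y i - u i)

lemma IsCombinedUpdate.lpValue_le {E : Type u} [Fintype E] [DecidableEq E] {kin kout : ℕ}
    (I : ProbingInstance E kin kout) {x x' : E → ℝ} {e : E} {k l : ℕ}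
    {u : Fin k → E → ℝ} {v : Fin l → E → ℝ} (h : IsCombinedUpdate I.p x e u v x')
    (hv : ∀ j i, v j i ≤ I.p i * x i) :
    I.lpValue x ≤ I.lpValue x' + I.w e * (I.p e * x e) +
      ∑ j, offLoss (fun i => I.w i * I.p i) e x (u j) +
      ∑ j, offLoss I.w e (fun i => I.p i * x i) (v j) := by
  have he : I.w e * (I.p e * x e) = ∑ i, if i = e then I.w i * (I.p i * x i) else 0 := by simp
  unfold ProbingInstance.lpValue offLoss
  rw [he, Finset.sum_comm (s := Finset.univ (α := Fin k)),
    Finset.sum_comm (s := Finset.univ (α := Fin l)), ← Finset.sum_add_distrib,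
    ← Finset.sum_add_distrib, ← Finset.sum_add_distrib]
  refine Finset.sum_le_sum fun i _ => ?_
  by_cases hi : i = e
  · subst hi
    simp [h.probed]
  simp only [hi, if_false, ← Finset.mul_sum, add_zero]
  have h1 := mul_le_mul_of_nonneg_left (h.loss_le i hi) (I.p_nonneg i)
  have h2 : I.p i * ∑ j, (I.p i * x i - v j i) / I.p i ≤ ∑ j, (I.p i * x i - v j i) := by
    rw [Finset.mul_sum]
    refine Finset.sum_le_sum fun j _ => ?_
    -- For `p i = 0` the left side is `0` and the right side is a nonnegative loss by `hv`;
    -- otherwise `p i` cancels.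
    rcases (I.p_nonneg i).eq_or_lt with h0 | h0
    · have := hv j i
      rw [← h0] at this ⊢
      simpa using this
    · exact le_of_eq (by field_simp)
  have h3 : I.p i * x i ≤ I.p i * x' i + I.p i * ∑ j, (x i - u j i) + ∑ j, (I.p i * x i - v j i) := by
    rw [mul_sub, mul_add] at h1
    linarith
  have h4 := mul_le_mul_of_nonneg_left h3 (I.w_nonneg i)
  linarith

/-! ### Existence of iterative randomized rounding -/

/-- The fractional solution `x` is feasible for the current matroids. -/
structure ProbingInstance.IsFractional {E : Type u} {kin kout : ℕ} (I : ProbingInstance E kin kout)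
    (x : E → ℝ) (Q S : Finset E) : Prop where
  nonneg : ∀ e, 0 ≤ x e
  inner : ∀ j, (fun e => I.p e * x e) ∈ matroidPolytope (I.inner j ／ (S : Set E))
  outer : ∀ j, x ∈ matroidPolytope (I.outer j ／ (Q : Set E))

lemma contract_insert {E : Type u} [DecidableEq E] (M : Matroid E) (e : E) (Q : Finset E) :
    M ／ ((insert e Q : Finset E) : Set E) = M ／ (Q : Set E) ／ {e} := by
  rw [Matroid.contract_contract, Finset.coe_insert, Set.union_singleton]

/-- Induction on the support size: an update zeroes the probed coordinate and raises none, while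
`mem_matroidPolytope_contract` keeps the vector feasible for the contracted matroids. -/
lemma exists_iterativeRounding {E : Type u} [Fintype E] [DecidableEq E] {kin kout : ℕ}
    (I : ProbingInstance E kin kout) (n : ℕ) : ∀ (x : E → ℝ) (Q S : Finset E),
    (Finset.univ.filter fun e => 0 < x e).card = n → I.IsFractional x Q S →
    ∃ π, I.IterativeRounding x Q S π := by
  classical
  induction n using Nat.strong_induction_on with
  | _ n ih =>
  intro x Q S hn hx
  by_cases hx0 : x = 0
  · subst hx0
    exact ⟨_, .done Q S⟩
  let out := fun j => (nonempty_convexSupport (hx.outer j)).some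
  let inn := fun j => (nonempty_convexSupport (hx.inner j)).some
  have hφ' : ∀ j a b, ∃ φ, IsExchangeMap (I.outer j ／ (Q : Set E)) ((out j).B a) ((out j).B b) φ :=
    fun j a b => exists_isExchangeMap ((out j).indep a) ((out j).indep b)
  have hψ' : ∀ j a b, ∃ φ, IsExchangeMap (I.inner j ／ (S : Set E)) ((inn j).B a) ((inn j).B b) φ :=
    fun j a b => exists_isExchangeMap ((inn j).indep a) ((inn j).indep b)
  choose φ hφ using hφ'
  choose ψ hψ using hψ'
  let x₁ : E → (∀ j, (out j).ι) → (∀ j, (inn j).ι) → E → ℝ := fun e a c =>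
    additiveUpdate I.p x e (fun j => (out j).updated (φ j) e (a j))
      (fun j => (inn j).updated (ψ j) e (c j))
  let x₀ : E → (∀ j, (out j).ι) → E → ℝ := fun e a =>
    additiveUpdate I.p x e (fun j => (out j).updated (φ j) e (a j)) (fun j : Fin 0 => j.elim0)
  have hx₁ : ∀ e a c, IsCombinedUpdate I.p x e (fun j => (out j).updated (φ j) e (a j))
      (fun j => (inn j).updated (ψ j) e (c j)) (x₁ e a c) := fun e a c =>
    isCombinedUpdate_additiveUpdate I.p_nonneg hx.nonneg (fun j i => (out j).updated_nonneg _ _ _ _)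
      (fun j i => (out j).updated_le _ _ _ _) (fun j i => (inn j).updated_nonneg _ _ _ _)
      (fun j i => (inn j).updated_le _ _ _ _)
  have hx₀ : ∀ e a, IsCombinedUpdate I.p x e (fun j => (out j).updated (φ j) e (a j))
      (fun j : Fin 0 => j.elim0) (x₀ e a) := fun e a =>
    isCombinedUpdate_additiveUpdate I.p_nonneg hx.nonneg (fun j i => (out j).updated_nonneg _ _ _ _)
      (fun j i => (out j).updated_le _ _ _ _) (fun j => j.elim0) (fun j => j.elim0)
  have hcard : ∀ e (x' : E → ℝ), 0 < x e → x' e = 0 → (∀ i, x' i ≤ x i) →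
      (Finset.univ.filter fun e => 0 < x' e).card < n := by
    intro e x' hxe hx'e hx'
    rw [← hn]
    refine Finset.card_lt_card ⟨fun i hi => ?_, fun h => ?_⟩
    · simp only [Finset.mem_filter, Finset.mem_univ, true_and] at hi ⊢
      exact hi.trans_le (hx' i)
    · have : e ∈ Finset.univ.filter fun e => 0 < x' e := h (by simpa using hxe)
      simp [hx'e] at this
  have h₁ : ∀ e a c, ∃ π, 0 < x e → 0 < I.p e → (∀ j, 0 < (out j).guideProb e (a j)) →
      (∀ j, 0 < (inn j).guideProb e (c j)) →
      I.IterativeRounding (x₁ e a c) (insert e Q) (insert e S) π := by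
    intro e a c
    by_cases H : 0 < x e ∧ 0 < I.p e ∧ (∀ j, 0 < (out j).guideProb e (a j)) ∧
      (∀ j, 0 < (inn j).guideProb e (c j))
    · obtain ⟨he, hp, ha, hc⟩ := H
      have hu := hx₁ e a c
      have hfrac : I.IsFractional (x₁ e a c) (insert e Q) (insert e S) := by
        refine ⟨hu.nonneg, fun j => ?_, fun j => ?_⟩
        · rw [contract_insert]
          exact (inn j).mem_matroidPolytope_contract ((inn j).mem_of_guideProb_pos (hc j))
            (fun b => hψ j _ b) (fun i => mul_nonneg (I.p_nonneg i) (hu.nonneg i))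
            (by simp [hu.probed]) (fun i hi => hu.le_right i hi j)
        · rw [contract_insert]
          exact (out j).mem_matroidPolytope_contract ((out j).mem_of_guideProb_pos (ha j))
            (fun b => hφ j _ b) hu.nonneg hu.probed (fun i hi => hu.le_left i hi j)
      obtain ⟨π, hπ⟩ := ih _ (hcard e (x₁ e a c) he hu.probed hu.le) _ _ _ rfl hfrac
      exact ⟨π, fun _ _ _ _ => hπ⟩
    · exact ⟨.done, fun a b c d => absurd ⟨a, b, c, d⟩ H⟩
  have h₀ : ∀ e a, ∃ π, 0 < x e → I.p e < 1 → (∀ j, 0 < (out j).guideProb e (a j)) →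
      I.IterativeRounding (x₀ e a) (insert e Q) S π := by
    intro e a
    by_cases H : 0 < x e ∧ I.p e < 1 ∧ (∀ j, 0 < (out j).guideProb e (a j))
    · obtain ⟨he, hp, ha⟩ := H
      have hu := hx₀ e a
      have hfrac : I.IsFractional (x₀ e a) (insert e Q) S := by
        refine ⟨hu.nonneg, fun j => ?_, fun j => ?_⟩
        -- For an inactive element the inner matroids are unchanged, and their polytopes are closed
        -- under decreasing coordinates.
        · exact mem_matroidPolytope_of_le (hx.inner j)
            (fun i => mul_nonneg (I.p_nonneg i) (hu.nonneg i))
            (fun i => mul_le_mul_of_nonneg_left (hu.le i) (I.p_nonneg i))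
        · rw [contract_insert]
          exact (out j).mem_matroidPolytope_contract ((out j).mem_of_guideProb_pos (ha j))
            (fun b => hφ j _ b) hu.nonneg hu.probed (fun i hi => hu.le_left i hi j)
      obtain ⟨π, hπ⟩ := ih _ (hcard e (x₀ e a) he hu.probed hu.le) _ _ _ rfl hfrac
      exact ⟨π, fun _ _ _ => hπ⟩
    · exact ⟨.done, fun a b c => absurd ⟨a, b, c⟩ H⟩
  choose π₁ hπ₁ using h₁
  choose π₀ hπ₀ using h₀
  exact ⟨_, .step hx0 out inn φ ψ hφ hψ x₁ π₁ x₀ π₀ (fun e a c _ _ _ _ => hx₁ e a c) hπ₁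
    (fun e a _ _ _ => hx₀ e a) hπ₀⟩

/-! ### The vector of probing probabilities of a policy -/

/-- The probability that a policy probes `i`, when `e` is active with probability `p e`. -/
noncomputable def Policy.probeProb {E : Type u} [DecidableEq E] (p : E → ℝ) : Policy E → E → ℝ
  | .done, _ => 0
  | .probe e π₁ π₀, i =>
      (if i = e then 1 else 0) + (p e * π₁.probeProb p i + (1 - p e) * π₀.probeProb p i)
  | @Policy.random _ ι _ q next, i => ∑ k : ι, q k * (next k).probeProb p i

namespace ProbingInstance

section

variable {E : Type u} [DecidableEq E] {kin kout : ℕ}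

lemma probeProb_nonneg (I : ProbingInstance E kin kout) (π : Policy E) :
    ∀ Q S : Finset E, I.Feasible π Q S → ∀ i, 0 ≤ π.probeProb I.p i := by
  induction π with
  | done => intro Q S _ i; simp [Policy.probeProb]
  | probe e π₁ π₀ ih₁ ih₀ =>
    rintro Q S ⟨-, -, hf₁, hf₀⟩ i
    rw [Policy.probeProb]
    have h₁ : 0 ≤ I.p e * π₁.probeProb I.p i := by
      rcases (I.p_nonneg e).eq_or_lt with h | h
      · simp [← h]
      · exact mul_nonneg h.le (ih₁ _ _ (hf₁ h).2 i)
    have h₀ : 0 ≤ (1 - I.p e) * π₀.probeProb I.p i := by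
      rcases (I.p_le_one e).eq_or_lt with h | h
      · simp [h]
      · exact mul_nonneg (sub_nonneg.2 h.le) (ih₀ _ _ (hf₀ h) i)
    have : (0 : ℝ) ≤ if i = e then 1 else 0 := by split_ifs <;> norm_num
    positivity
  | random q next ih =>
    rintro Q S ⟨hq0, -, hf⟩ i
    rw [Policy.probeProb]
    refine Finset.sum_nonneg fun k _ => ?_
    rcases (hq0 k).eq_or_lt with h | h
    · simp [← h]
    · exact mul_nonneg h.le (ih k _ _ (hf k h) i)

/-- If along every branch of a feasible policy at most `r` elements of `A` are probed, then their
expected number is at most `r`. -/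
lemma card_add_sum_probeProb_le (I : ProbingInstance E kin kout) (A : Finset E) (r : ℝ)
    (hr : ∀ Q : Finset E, (∀ j, (I.outer j).Indep (Q : Set E)) → ((Q ∩ A).card : ℝ) ≤ r)
    (π : Policy E) : ∀ Q S : Finset E, (∀ j, (I.outer j).Indep (Q : Set E)) → I.Feasible π Q S →
      ((Q ∩ A).card : ℝ) + ∑ i ∈ A, π.probeProb I.p i ≤ r := by
  induction π with
  | done => intro Q S hQ _; simpa [Policy.probeProb] using hr Q hQ
  | probe e π₁ π₀ ih₁ ih₀ =>
    rintro Q S hQ ⟨heQ, hout, hf₁, hf₀⟩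
    simp_rw [Policy.probeProb]
    rw [Finset.sum_add_distrib, Finset.sum_add_distrib, ← Finset.mul_sum, ← Finset.mul_sum]
    have hc : ((Q ∩ A).card : ℝ) + ∑ i ∈ A, (if i = e then (1 : ℝ) else 0) =
        ((insert e Q ∩ A).card : ℝ) := by
      rw [Finset.sum_ite_eq']
      split_ifs with h
      · rw [Finset.insert_inter_of_mem h, Finset.card_insert_of_notMem (by simp [heQ])]
        push_cast; rfl
      · rw [Finset.insert_inter_of_notMem h, add_zero]
    rw [← add_assoc, hc]
    have h₁ : I.p e * ∑ i ∈ A, π₁.probeProb I.p i ≤ I.p e * (r - (insert e Q ∩ A).card) := by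
      rcases (I.p_nonneg e).eq_or_lt with h | h
      · simp [← h]
      · exact mul_le_mul_of_nonneg_left (by linarith [ih₁ _ _ hout (hf₁ h).2]) h.le
    have h₀ : (1 - I.p e) * ∑ i ∈ A, π₀.probeProb I.p i ≤
        (1 - I.p e) * (r - (insert e Q ∩ A).card) := by
      rcases (I.p_le_one e).eq_or_lt with h | h
      · simp [h]
      · exact mul_le_mul_of_nonneg_left (by linarith [ih₀ _ _ hout (hf₀ h)]) (sub_nonneg.2 h.le)
    linarith
  | random q next ih =>
    rintro Q S hQ ⟨hq0, hq1, hf⟩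
    simp_rw [Policy.probeProb]
    rw [Finset.sum_comm]
    have h : ∀ k, ∑ i ∈ A, q k * (next k).probeProb I.p i ≤ q k * (r - (Q ∩ A).card) := by
      intro k
      rw [← Finset.mul_sum]
      rcases (hq0 k).eq_or_lt with h | h
      · simp [← h]
      · exact mul_le_mul_of_nonneg_left (by linarith [ih k _ _ hQ (hf k h)]) h.le
    have h2 := Finset.sum_le_sum fun k (_ : k ∈ Finset.univ) => h k
    rw [← Finset.sum_mul, hq1, one_mul] at h2
    linarith

/-- The analogue of `card_add_sum_probeProb_le` for the active probed elements of `A`. -/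
lemma card_add_sum_mul_probeProb_le (I : ProbingInstance E kin kout) (A : Finset E) (r : ℝ)
    (hr : ∀ S : Finset E, (∀ j, (I.inner j).Indep (S : Set E)) → ((S ∩ A).card : ℝ) ≤ r)
    (π : Policy E) : ∀ Q S : Finset E, S ⊆ Q → (∀ j, (I.inner j).Indep (S : Set E)) →
      I.Feasible π Q S → ((S ∩ A).card : ℝ) + ∑ i ∈ A, I.p i * π.probeProb I.p i ≤ r := by
  induction π with
  | done => intro Q S _ hS _; simpa [Policy.probeProb] using hr S hS
  | probe e π₁ π₀ ih₁ ih₀ =>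
    rintro Q S hSQ hS ⟨heQ, -, hf₁, hf₀⟩
    have heS : e ∉ S := fun h => heQ (hSQ h)
    -- The factor `p e` in front of the new probe is charged entirely to the active branch, the one
    -- in which `S` grows.
    have hsum : ∑ i ∈ A, I.p i * (Policy.probe e π₁ π₀).probeProb I.p i =
        I.p e * ((if e ∈ A then 1 else 0) + ∑ i ∈ A, I.p i * π₁.probeProb I.p i) +
          (1 - I.p e) * ∑ i ∈ A, I.p i * π₀.probeProb I.p i := by
      rw [← Finset.sum_ite_eq' A e (fun _ => (1 : ℝ)), ← Finset.sum_add_distrib, Finset.mul_sum,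
        Finset.mul_sum, ← Finset.sum_add_distrib]
      refine Finset.sum_congr rfl fun i _ => ?_
      rw [Policy.probeProb]
      by_cases hi : i = e
      · subst hi; simp; ring
      · simp only [hi, if_false]; ring
    rw [hsum]
    have hc : ((S ∩ A).card : ℝ) + (if e ∈ A then (1 : ℝ) else 0) =
        ((insert e S ∩ A).card : ℝ) := by
      split_ifs with h
      · rw [Finset.insert_inter_of_mem h, Finset.card_insert_of_notMem (by simp [heS])]
        push_cast; rfl
      · rw [Finset.insert_inter_of_notMem h, add_zero]
    have h₁ : I.p e * ((if e ∈ A then 1 else 0) + ∑ i ∈ A, I.p i * π₁.probeProb I.p i) ≤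
        I.p e * (r - (S ∩ A).card) := by
      rcases (I.p_nonneg e).eq_or_lt with h | h
      · simp [← h]
      · exact mul_le_mul_of_nonneg_left (by
          linarith [ih₁ _ _ (Finset.insert_subset_insert e hSQ) (hf₁ h).1 (hf₁ h).2]) h.le
    have h₀ : (1 - I.p e) * ∑ i ∈ A, I.p i * π₀.probeProb I.p i ≤
        (1 - I.p e) * (r - (S ∩ A).card) := by
      rcases (I.p_le_one e).eq_or_lt with h | h
      · simp [h]
      · exact mul_le_mul_of_nonneg_left (by
          linarith [ih₀ _ _ (hSQ.trans (Finset.subset_insert e Q)) hS (hf₀ h)]) (sub_nonneg.2 h.le)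
    linarith
  | random q next ih =>
    rintro Q S hSQ hS ⟨hq0, hq1, hf⟩
    simp_rw [Policy.probeProb, Finset.mul_sum]
    rw [Finset.sum_comm]
    have h : ∀ k, ∑ i ∈ A, I.p i * (q k * (next k).probeProb I.p i) ≤
        q k * (r - (S ∩ A).card) := by
      intro k
      simp_rw [mul_left_comm (I.p _) (q k)]
      rw [← Finset.mul_sum]
      rcases (hq0 k).eq_or_lt with h | h
      · simp [← h]
      · exact mul_le_mul_of_nonneg_left (by linarith [ih k _ _ hSQ hS (hf k h)]) h.le
    have h2 := Finset.sum_le_sum fun k (_ : k ∈ Finset.univ) => h k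
    rw [← Finset.sum_mul, hq1, one_mul] at h2
    linarith

/-- The counting lemma for `A = {i}` with bound `1`; it rests on probes being distinct rather than
on any matroid. -/
lemma probeProb_le_one (I : ProbingInstance E kin kout) {π : Policy E} (hπ : I.IsPolicy π)
    (i : E) : π.probeProb I.p i ≤ 1 := by
  have := I.card_add_sum_probeProb_le {i} 1 (fun Q _ => by
    exact_mod_cast (Finset.card_le_card Finset.inter_subset_right).trans (by simp)) π ∅ ∅
    (by simp) hπ
  simpa using this

end

variable {E : Type u} [Fintype E] [DecidableEq E] {kin kout : ℕ}

lemma lpValue_probe (I : ProbingInstance E kin kout) (e : E) (π₁ π₀ : Policy E) :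
    I.lpValue ((Policy.probe e π₁ π₀).probeProb I.p) = I.w e * I.p e +
      (I.p e * I.lpValue (π₁.probeProb I.p) + (1 - I.p e) * I.lpValue (π₀.probeProb I.p)) := by
  have : I.w e * I.p e = ∑ i, if i = e then I.w i * I.p i else 0 := by simp
  unfold lpValue
  rw [this, Finset.mul_sum, Finset.mul_sum, ← Finset.sum_add_distrib, ← Finset.sum_add_distrib]
  refine Finset.sum_congr rfl fun i _ => ?_
  rw [Policy.probeProb]
  split_ifs <;> ring

lemma lpValue_random (I : ProbingInstance E kin kout) {ι : Type u} [Fintype ι] (q : ι → ℝ)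
    (next : ι → Policy E) :
    I.lpValue ((Policy.random q next).probeProb I.p) =
      ∑ k, q k * I.lpValue ((next k).probeProb I.p) := by
  unfold lpValue
  simp_rw [Policy.probeProb, Finset.mul_sum]
  rw [Finset.sum_comm]
  refine Finset.sum_congr rfl fun k _ => Finset.sum_congr rfl fun i _ => ?_
  ring

/-! ### The expected weight -/

lemma sum_activeProb (I : ProbingInstance E kin kout) : ∑ A : Finset E, I.activeProb A = 1 := by
  have h := Finset.prod_add I.p (fun e => 1 - I.p e) Finset.univ
  simp only [add_sub_cancel, Finset.prod_const_one, Finset.powerset_univ] at h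
  rw [h]
  exact Finset.sum_congr rfl fun A _ => by rw [activeProb, Finset.compl_eq_univ_sdiff]

/-- Subsets are paired as `A`, `insert e A` with `e ∉ A`; the common factor is the probability of
the pattern off `e`. -/
lemma sum_activeProb_eq (I : ProbingInstance E kin kout) (e : E) (g : Finset E → ℝ) :
    ∑ A, I.activeProb A * g A = ∑ A ∈ (Finset.univ.erase e).powerset,
      ((∏ i ∈ A, I.p i) * ∏ i ∈ (insert e A)ᶜ, (1 - I.p i)) *
        ((1 - I.p e) * g A + I.p e * g (insert e A)) := by
  have h : ∑ A, I.activeProb A * g A =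
      ∑ A ∈ (insert e (Finset.univ.erase e)).powerset, I.activeProb A * g A := by
    rw [Finset.insert_erase (Finset.mem_univ e), Finset.powerset_univ]
  rw [h, Finset.sum_powerset_insert (Finset.notMem_erase _ _), ← Finset.sum_add_distrib]
  refine Finset.sum_congr rfl fun A hA => ?_
  have heA : e ∉ A := fun h => by simpa using Finset.mem_powerset.1 hA h
  have hc : Aᶜ = insert e (insert e A)ᶜ := by
    ext i
    by_cases hi : i = e
    · simp [hi, heA]
    · simp [hi]
  unfold activeProb
  rw [Finset.prod_insert heA]
  nth_rw 1 [hc]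
  rw [Finset.prod_insert (by simp)]
  ring

/-- Conditioning on whether `e` is active. -/
lemma sum_activeProb_cond (I : ProbingInstance E kin kout) (e : E) (g : Finset E → ℝ) :
    ∑ A, I.activeProb A * g A = I.p e * ∑ A, I.activeProb A * g (insert e A) +
      (1 - I.p e) * ∑ A, I.activeProb A * g (A.erase e) := by
  rw [I.sum_activeProb_eq e g, I.sum_activeProb_eq e fun A => g (insert e A),
    I.sum_activeProb_eq e fun A => g (A.erase e), Finset.mul_sum, Finset.mul_sum,
    ← Finset.sum_add_distrib]
  refine Finset.sum_congr rfl fun A hA => ?_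
  have heA : e ∉ A := fun h => by simpa using Finset.mem_powerset.1 hA h
  rw [Finset.insert_idem, Finset.erase_eq_of_notMem heA, Finset.erase_insert heA]
  ring

/-- The expected weight of a feasible policy, given that the active elements in `Q` are those
in `C`. -/
lemma sum_activeProb_valueOn (I : ProbingInstance E kin kout) (π : Policy E) :
    ∀ Q S C : Finset E, S ⊆ Q → C ⊆ Q → I.Feasible π Q S →
      ∑ A, I.activeProb A * π.valueOn I.weight ((A \ Q) ∪ C) S =
        I.weight S + I.lpValue (π.probeProb I.p) := by
  induction π with
  | done =>
    intro Q S C _ _ _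
    simp [Policy.valueOn, Policy.probeProb, lpValue, ← Finset.sum_mul, sum_activeProb]
  | probe e π₁ π₀ ih₁ ih₀ =>
    intro Q S C hS hC hf
    obtain ⟨heQ, -, hf₁, hf₀⟩ := hf
    have heC : e ∉ C := fun h => heQ (hC h)
    have heS : e ∉ S := fun h => heQ (hS h)
    -- As `e ∉ Q`, its state is still random; after conditioning, the outcome is recorded by moving
    -- `e` into `Q`, and into `C` if active.
    rw [I.sum_activeProb_cond e, lpValue_probe]
    have h₁ : I.p e * ∑ A, I.activeProb A *
        (Policy.probe e π₁ π₀).valueOn I.weight ((insert e A \ Q) ∪ C) S =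
        I.p e * (I.weight S + I.w e + I.lpValue (π₁.probeProb I.p)) := by
      rcases (I.p_nonneg e).eq_or_lt with h | h
      · simp [← h]
      congr 1
      rw [show I.weight S + I.w e = I.weight (insert e S) by
        rw [weight, weight, Finset.sum_insert heS, add_comm],
        ← ih₁ (insert e Q) (insert e S) (insert e C) (Finset.insert_subset_insert _ hS)
          (Finset.insert_subset_insert _ hC) (hf₁ h).2]
      refine Finset.sum_congr rfl fun A _ => ?_
      rw [Policy.valueOn, if_pos (by simp [heQ])]
      congr 2
      ext i
      by_cases hi : i = e
      · simp [hi, heQ]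
      · simp [hi]
    have h₀ : (1 - I.p e) * ∑ A, I.activeProb A *
        (Policy.probe e π₁ π₀).valueOn I.weight ((A.erase e \ Q) ∪ C) S =
        (1 - I.p e) * (I.weight S + I.lpValue (π₀.probeProb I.p)) := by
      rcases (I.p_le_one e).eq_or_lt with h | h
      · simp [h]
      congr 1
      rw [← ih₀ (insert e Q) S C (hS.trans (Finset.subset_insert _ _))
        (hC.trans (Finset.subset_insert _ _)) (hf₀ h)]
      refine Finset.sum_congr rfl fun A _ => ?_
      rw [Policy.valueOn, if_neg (by simp [heC])]
      congr 2
      ext i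
      by_cases hi : i = e
      · simp [hi, heC]
      · simp [hi]
    rw [h₁, h₀]
    ring
  | random q next ih =>
    intro Q S C hS hC hf
    obtain ⟨hq0, hq1, hf⟩ := hf
    rw [lpValue_random]
    simp_rw [Policy.valueOn, Finset.mul_sum]
    rw [Finset.sum_comm]
    have : I.weight S = ∑ k, q k * I.weight S := by rw [← Finset.sum_mul, hq1, one_mul]
    rw [this, ← Finset.sum_add_distrib]
    refine Finset.sum_congr rfl fun k _ => ?_
    rcases (hq0 k).eq_or_lt with h | h
    · simp [← h]
    · rw [← mul_add, ← ih k Q S C hS hC (hf k h), Finset.mul_sum]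
      exact Finset.sum_congr rfl fun A _ => by ring

lemma expectedWeight_eq (I : ProbingInstance E kin kout) {π : Policy E} (hπ : I.IsPolicy π) :
    I.expectedWeight π = I.lpValue (π.probeProb I.p) := by
  have := I.sum_activeProb_valueOn π ∅ ∅ ∅ subset_rfl subset_rfl hπ
  simpa [expectedWeight, weight] using this

/-! ### The LP relaxation bounds every policy -/

lemma probeProb_mem_lpRegion (I : ProbingInstance E kin kout) {π : Policy E} (hπ : I.IsPolicy π) :
    π.probeProb I.p ∈ I.lpRegion := by
  have h0 := I.probeProb_nonneg π ∅ ∅ hπ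
  refine ⟨fun i => ⟨h0 i, I.probeProb_le_one hπ i⟩,
    fun j => ⟨fun i => mul_nonneg (I.p_nonneg i) (h0 i), fun A => ?_⟩, fun j => ⟨h0, fun A => ?_⟩⟩
  · have := I.card_add_sum_mul_probeProb_le A _ (fun S hS =>
      Nat.cast_le.2 (Indep.card_inter_le_eRk (hS j) A)) π ∅ ∅ subset_rfl (by simp) hπ
    simpa using this
  · have := I.card_add_sum_probeProb_le A _ (fun S hS =>
      Nat.cast_le.2 (Indep.card_inter_le_eRk (hS j) A)) π ∅ ∅ (by simp) hπ
    simpa using this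

lemma IsLPOptimal.expectedWeight_le {I : ProbingInstance E kin kout} {x : E → ℝ}
    (hx : I.IsLPOptimal x) {σ : Policy E} (hσ : I.IsPolicy σ) :
    I.expectedWeight σ ≤ I.lpValue x := by
  rw [I.expectedWeight_eq hσ]
  exact hx.2 _ (I.probeProb_mem_lpRegion hσ)

end ProbingInstance

/-! ### Expectations over independent draws -/

lemma sum_pi_prod_eq_one {k : ℕ} {ι : Fin k → Type u} [∀ j, Fintype (ι j)] {P : ∀ j, ι j → ℝ}
    (hP : ∀ j, ∑ t, P j t = 1) : ∑ a : ∀ j, ι j, ∏ j, P j (a j) = 1 := by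
  have h := Finset.prod_univ_sum (fun j => (Finset.univ : Finset (ι j))) P
  rw [Fintype.piFinset_univ] at h
  rw [← h]
  simp [hP]

/-- Linearity of expectation: the term for `j` sees only the `j`-th marginal, as the other factors
sum to `1`. -/
lemma sum_pi_prod_mul_sum {k : ℕ} {ι : Fin k → Type u} [∀ j, Fintype (ι j)] {P : ∀ j, ι j → ℝ}
    (hP : ∀ j, ∑ t, P j t = 1) (h : ∀ j, ι j → ℝ) :
    ∑ a : ∀ j, ι j, (∏ j, P j (a j)) * ∑ j, h j (a j) = ∑ j, ∑ t, P j t * h j t := by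
  simp_rw [Finset.mul_sum]
  rw [Finset.sum_comm]
  refine Finset.sum_congr rfl fun j₀ _ => ?_
  have h1 := Finset.prod_univ_sum (fun j => (Finset.univ : Finset (ι j)))
    (fun j t => P j t * if j = j₀ then h j t else 1)
  rw [Fintype.piFinset_univ] at h1
  have h2 : ∀ a : ∀ j, ι j, (∏ j, P j (a j) * if j = j₀ then h j (a j) else 1) =
      (∏ j, P j (a j)) * h j₀ (a j₀) := by
    intro a
    rw [Finset.prod_mul_distrib, Finset.prod_ite_eq' Finset.univ j₀ (fun j => h j (a j))]
    simp
  rw [← Finset.sum_congr rfl fun a _ => h2 a, ← h1, Finset.prod_eq_single j₀]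
  · simp
  · intro j _ hj
    simp [hj, hP]
  · simp

lemma sum_prod_mul_sub {α γ : Type*} [Fintype α] [Fintype γ] {P : α → ℝ} {R : γ → ℝ}
    (hP : ∑ a, P a = 1) (hR : ∑ c, R c = 1) (D : ℝ) (F : α → ℝ) (G : γ → ℝ) :
    ∑ g : α × γ, (P g.1 * R g.2) * (D - F g.1 - G g.2) =
      D - ∑ a, P a * F a - ∑ c, R c * G c := by
  rw [Fintype.sum_prod_type]
  have : ∀ a, ∑ c, (P a * R c) * (D - F a - G c) = P a * (D - F a - ∑ c, R c * G c) := by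
    intro a
    have h1 : ∑ c, (P a * R c) * (D - F a - G c) =
        P a * ((∑ c, R c) * (D - F a) - ∑ c, R c * G c) := by
      rw [Finset.sum_mul, ← Finset.sum_sub_distrib, Finset.mul_sum]
      exact Finset.sum_congr rfl fun c _ => by ring
    rw [h1, hR, one_mul]
  simp_rw [this, mul_sub]
  rw [Finset.sum_sub_distrib, Finset.sum_sub_distrib, ← Finset.sum_mul, ← Finset.sum_mul, hP,
    one_mul, one_mul]

lemma pos_of_prod_pos {k : ℕ} {f : Fin k → ℝ} (h0 : ∀ j, 0 ≤ f j) (h : 0 < ∏ j, f j) (j : Fin k) :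
    0 < f j :=
  lt_of_le_of_ne (h0 j) fun hj =>
    h.ne' (Finset.prod_eq_zero (Finset.mem_univ j) hj.symm)

/-- The expected loss of a nonnegative linear functional in the update of one constraint. -/
lemma ConvexSupport.sum_expected_offLoss_le {E : Type u} [Fintype E] [DecidableEq E]
    {M : Matroid E} {y : E → ℝ} (s : ConvexSupport M y) {φ : s.ι → s.ι → E → Option E}
    (hφ : ∀ a b, IsExchangeMap M (s.B a) (s.B b) (φ a b)) {c : E → ℝ} (hc : ∀ i, 0 ≤ c i) :
    ∑ e, y e * ∑ a, s.guideProb e a * offLoss c e y (s.updated φ e a) ≤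
      ∑ i, c i * (y i * (1 - y i)) := by
  calc ∑ e, y e * ∑ a, s.guideProb e a * offLoss c e y (s.updated φ e a)
      = ∑ i, c i * ∑ e, y e * ∑ a, s.guideProb e a *
          (if i = e then 0 else y i - s.updated φ e a i) := by
        unfold offLoss
        simp_rw [Finset.mul_sum]
        rw [Finset.sum_comm]
        rw [Finset.sum_comm (s := (Finset.univ : Finset E)) (t := (Finset.univ : Finset E))]
        rw [Finset.sum_comm]
        refine Finset.sum_congr rfl fun e _ => ?_
        rw [Finset.sum_comm]
        refine Finset.sum_congr rfl fun i _ => Finset.sum_congr rfl fun a _ => ?_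
        ring
    _ ≤ _ := Finset.sum_le_sum fun i _ =>
        mul_le_mul_of_nonneg_left (s.expected_loss_le hφ i) (hc i)

namespace ProbingInstance

variable {E : Type u} [Fintype E] [DecidableEq E] {kin kout : ℕ}

/-! ### Iterative randomized rounding is a policy -/

lemma IterativeRounding.feasible {I : ProbingInstance E kin kout} (hkout : 1 ≤ kout)
    {x : E → ℝ} {Q S : Finset E} {π : Policy E} (h : I.IterativeRounding x Q S π) :
    (∀ j, (I.outer j).Indep (Q : Set E)) → (∀ j, (I.inner j).Indep (S : Set E)) →
      I.Feasible π Q S := by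
  induction h with
  | done => intro _ _; trivial
  | @step x Q S hx out inn φ ψ hφ hψ x₁ π₁ x₀ π₀ hx₁ hπ₁ hx₀ hπ₀ ih₁ ih₀ =>
    intro hQ hS
    have hx0 : ∀ e, 0 ≤ x e := (out ⟨0, hkout⟩).nonneg_vec
    have hX : 0 < ∑ i, x i := by
      refine lt_of_le_of_ne (Finset.sum_nonneg fun i _ => hx0 i) fun h => hx ?_
      ext i
      exact (Finset.sum_eq_zero_iff_of_nonneg fun i _ => hx0 i).1 h.symm i (Finset.mem_univ i)
    refine ⟨fun e => div_nonneg (hx0 e) hX.le, by rw [← Finset.sum_div, div_self hX.ne'],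
      fun e he => ?_⟩
    have hxe : 0 < x e := (div_pos_iff_of_pos_right hX).1 he
    -- Since `x e > 0`, some set of the support contains `e`, so `{e}` is independent in the
    -- contraction; this gives both freshness of `e` and independence of `Q + e`.
    have houtQ : ∀ j, Disjoint ({e} : Set E) Q ∧ (I.outer j).Indep ({e} ∪ (Q : Set E)) :=
      fun j => (hQ j).contract_indep_iff.1 ((out j).indep_singleton hxe)
    have hout : ∀ j, (I.outer j).Indep ((insert e Q : Finset E) : Set E) := fun j => by
      rw [Finset.coe_insert, Set.insert_eq]
      exact (houtQ j).2
    have hg0 : ∀ j t, 0 ≤ (out j).guideProb e t := fun j t => (out j).guideProb_nonneg e t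
    have hi0 : ∀ j t, 0 ≤ (inn j).guideProb e t := fun j t => (inn j).guideProb_nonneg e t
    have hgs := sum_pi_prod_eq_one fun j => (out j).sum_guideProb hxe
    refine ⟨by simpa using (houtQ ⟨0, hkout⟩).1, hout, fun hp => ?_, fun hp => ?_⟩
    · have hinn : ∀ j, (I.inner j).Indep ((insert e S : Finset E) : Set E) := fun j => by
        have := (hS j).contract_indep_iff.1 ((inn j).indep_singleton (mul_pos hp hxe))
        rw [Finset.coe_insert, Set.insert_eq]
        exact this.2
      have his := sum_pi_prod_eq_one fun j => (inn j).sum_guideProb (mul_pos hp hxe)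
      refine ⟨hinn, fun g => mul_nonneg (Finset.prod_nonneg fun j _ => hg0 j _)
        (Finset.prod_nonneg fun j _ => hi0 j _), ?_, fun g hg => ?_⟩
      · rw [Fintype.sum_prod_type]
        simp_rw [← Finset.mul_sum]
        rw [his]
        simpa using hgs
      · have h1 := Finset.prod_nonneg fun j (_ : j ∈ Finset.univ) => hg0 j (g.1 j)
        have h2 := Finset.prod_nonneg fun j (_ : j ∈ Finset.univ) => hi0 j (g.2 j)
        exact ih₁ e g.1 g.2 hxe hp (pos_of_prod_pos (fun j => hg0 j _) (pos_of_mul_pos_left hg h2))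
          (pos_of_prod_pos (fun j => hi0 j _) (pos_of_mul_pos_right hg h1)) hout hinn
    · exact ⟨fun a => Finset.prod_nonneg fun j _ => hg0 j _, hgs,
        fun a ha => ih₀ e a hxe hp (pos_of_prod_pos (fun j => hg0 j _) ha) hout hS⟩

/-! ### The approximation guarantee -/

lemma IterativeRounding.lpValue_le {I : ProbingInstance E kin kout} (hkout : 1 ≤ kout)
    {x : E → ℝ} {Q S : Finset E} {π : Policy E} (h : I.IterativeRounding x Q S π) :
    I.lpValue x ≤ ((kin : ℝ) + kout) * I.lpValue (π.probeProb I.p) := by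
  induction h with
  | done => simp [lpValue, Policy.probeProb]
  | @step x Q S hx out inn φ ψ hφ hψ x₁ π₁ x₀ π₀ hx₁ hπ₁ hx₀ hπ₀ ih₁ ih₀ =>
    have hx0 : ∀ e, 0 ≤ x e := (out ⟨0, hkout⟩).nonneg_vec
    have hX : 0 < ∑ i, x i := by
      refine lt_of_le_of_ne (Finset.sum_nonneg fun i _ => hx0 i) fun h => hx ?_
      ext i
      exact (Finset.sum_eq_zero_iff_of_nonneg fun i _ => hx0 i).1 h.symm i (Finset.mem_univ i)
    set K : ℝ := (kin : ℝ) + kout with hK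
    let LO : ∀ j, E → (out j).ι → ℝ := fun j e t =>
      offLoss (fun i => I.w i * I.p i) e x ((out j).updated (φ j) e t)
    let LI : ∀ j, E → (inn j).ι → ℝ := fun j e t =>
      offLoss I.w e (fun i => I.p i * x i) ((inn j).updated (ψ j) e t)
    let EO : E → ℝ := fun e => ∑ j, ∑ t, (out j).guideProb e t * LO j e t
    let EI : E → ℝ := fun e => ∑ j, ∑ t, (inn j).guideProb e t * LI j e t
    let D : E → ℝ := fun e => I.lpValue x - I.w e * (I.p e * x e)
    have hg0 : ∀ e j t, 0 ≤ (out j).guideProb e t := fun e j t => (out j).guideProb_nonneg e t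
    have hi0 : ∀ e j t, 0 ≤ (inn j).guideProb e t := fun e j t => (inn j).guideProb_nonneg e t
    -- The one-step balance given that `e` is probed: old potential against `K` times the
    -- continuation value (the immediate gain `w e * p e` subtracted), plus the own-coordinate,
    -- outer and inner losses. Inner losses occur only if `e` is active, hence `p e * EI e`.
    have hprobe : ∀ e, x e * (I.lpValue x) ≤ x e * (K * I.lpValue (Policy.probeProb I.p
        (.probe e
            (.random (fun g : (∀ j, (out j).ι) × (∀ j, (inn j).ι) =>
                (∏ j, (out j).guideProb e (g.1 j)) * ∏ j, (inn j).guideProb e (g.2 j))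
              fun g => π₁ e g.1 g.2)
            (.random (fun a : ∀ j, (out j).ι => ∏ j, (out j).guideProb e (a j))
              fun a => π₀ e a))) - K * (I.w e * I.p e) + I.w e * (I.p e * x e) + EO e +
              I.p e * EI e) := by
      intro e
      rcases (hx0 e).eq_or_lt with h | hxe
      · simp [← h]
      refine mul_le_mul_of_nonneg_left ?_ hxe.le
      rw [lpValue_probe, lpValue_random, lpValue_random]
      have hgs := sum_pi_prod_eq_one fun j => (out j).sum_guideProb hxe
      have h₁ : I.p e * (D e - EO e - EI e) ≤ I.p e * (K *
          ∑ g : (∀ j, (out j).ι) × (∀ j, (inn j).ι), ((∏ j, (out j).guideProb e (g.1 j)) *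
            ∏ j, (inn j).guideProb e (g.2 j)) * I.lpValue ((π₁ e g.1 g.2).probeProb I.p)) := by
        rcases (I.p_nonneg e).eq_or_lt with h | hp
        · simp [← h]
        refine mul_le_mul_of_nonneg_left ?_ hp.le
        have his := sum_pi_prod_eq_one fun j => (inn j).sum_guideProb (mul_pos hp hxe)
        have hexp := sum_prod_mul_sub hgs his (D e) (fun a => ∑ j, LO j e (a j))
          (fun c => ∑ j, LI j e (c j))
        rw [sum_pi_prod_mul_sum (fun j => (out j).sum_guideProb hxe),
          sum_pi_prod_mul_sum (fun j => (inn j).sum_guideProb (mul_pos hp hxe))] at hexp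
        refine hexp.symm.le.trans ?_
        rw [Finset.mul_sum]
        refine Finset.sum_le_sum fun g _ => ?_
        rw [mul_left_comm]
        have h1 := Finset.prod_nonneg fun j (_ : j ∈ Finset.univ) => hg0 e j (g.1 j)
        have h2 := Finset.prod_nonneg fun j (_ : j ∈ Finset.univ) => hi0 e j (g.2 j)
        rcases (mul_nonneg h1 h2).eq_or_lt with hz | hg
        · rw [← hz, zero_mul, zero_mul]
        refine mul_le_mul_of_nonneg_left ?_ hg.le
        have ha := pos_of_prod_pos (fun j => hg0 e j _) (pos_of_mul_pos_left hg h2)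
        have hc := pos_of_prod_pos (fun j => hi0 e j _) (pos_of_mul_pos_right hg h1)
        have hloss := (hx₁ e g.1 g.2 hxe hp ha hc).lpValue_le I
          (fun j i => (inn j).updated_le _ _ _ _)
        have := ih₁ e g.1 g.2 hxe hp ha hc
        simp only [D, LO, LI]
        linarith
      have h₀ : (1 - I.p e) * (D e - EO e) ≤ (1 - I.p e) * (K *
          ∑ a : ∀ j, (out j).ι, (∏ j, (out j).guideProb e (a j)) *
            I.lpValue ((π₀ e a).probeProb I.p)) := by
        rcases (I.p_le_one e).eq_or_lt with h | hp
        · simp [h]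
        refine mul_le_mul_of_nonneg_left ?_ (sub_nonneg.2 hp.le)
        have hexp : ∑ a : ∀ j, (out j).ι, (∏ j, (out j).guideProb e (a j)) *
            (D e - ∑ j, LO j e (a j)) = D e - EO e := by
          simp_rw [mul_sub]
          rw [Finset.sum_sub_distrib, sum_pi_prod_mul_sum (fun j => (out j).sum_guideProb hxe),
            ← Finset.sum_mul, hgs, one_mul]
        rw [← hexp, Finset.mul_sum]
        refine Finset.sum_le_sum fun a _ => ?_
        rw [mul_left_comm]
        have h1 := Finset.prod_nonneg fun j (_ : j ∈ Finset.univ) => hg0 e j (a j)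
        rcases h1.eq_or_lt with hz | hg
        · rw [← hz, zero_mul, zero_mul]
        refine mul_le_mul_of_nonneg_left ?_ hg.le
        have ha := pos_of_prod_pos (fun j => hg0 e j _) hg
        have hloss := (hx₀ e a hxe hp ha).lpValue_le I (fun j => j.elim0)
        rw [Fin.sum_univ_zero, add_zero] at hloss
        have := ih₀ e a hxe hp ha
        simp only [D, LO]
        linarith
      simp only [D] at h₁ h₀
      linarith
    have hwp : ∀ i, 0 ≤ I.w i * I.p i := fun i => mul_nonneg (I.w_nonneg i) (I.p_nonneg i)
    have hEO : ∑ e, x e * EO e ≤ kout * ∑ i, I.w i * I.p i * (x i * (1 - x i)) := by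
      simp only [EO]
      simp_rw [Finset.mul_sum (s := (Finset.univ : Finset (Fin kout)))]
      rw [Finset.sum_comm]
      calc _ ≤ ∑ _j : Fin kout, ∑ i, I.w i * I.p i * (x i * (1 - x i)) :=
            Finset.sum_le_sum fun j _ => (out j).sum_expected_offLoss_le (hφ j) hwp
        _ = _ := by simp
    -- Here `p e * x e` is the coordinate of the inner vector itself, so the estimate for one
    -- support applies; the saving `1 - y i` is not needed.
    have hEI : ∑ e, x e * (I.p e * EI e) ≤ kin * I.lpValue x := by
      simp only [EI]
      simp_rw [Finset.mul_sum (s := (Finset.univ : Finset (Fin kin)))]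
      rw [Finset.sum_comm]
      calc _ ≤ ∑ _j : Fin kin, I.lpValue x := by
            refine Finset.sum_le_sum fun j _ => ?_
            have := (inn j).sum_expected_offLoss_le (hψ j) I.w_nonneg
            simp_rw [← mul_assoc (x _), mul_comm (x _) (I.p _)]
            refine this.trans ?_
            unfold lpValue
            refine Finset.sum_le_sum fun i _ => mul_le_mul_of_nonneg_left ?_ (I.w_nonneg i)
            have := mul_nonneg (I.p_nonneg i) (hx0 i)
            nlinarith
        _ = _ := by simp
    -- Coordinatewise this is `x² + kout * x * (1 - x) ≤ kout * x`, that is, `kout ≥ 1`: one outer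
    -- matroid pays for zeroing the probed coordinate.
    have hown : ∑ e, x e * (I.w e * (I.p e * x e)) + kout * ∑ i, I.w i * I.p i * (x i * (1 - x i)) ≤
        kout * I.lpValue x := by
      unfold lpValue
      rw [Finset.mul_sum, Finset.mul_sum, ← Finset.sum_add_distrib]
      refine Finset.sum_le_sum fun i _ => ?_
      have h1 : (1 : ℝ) ≤ kout := by exact_mod_cast hkout
      have h2 : 0 ≤ I.w i * I.p i * (x i * x i) * ((kout : ℝ) - 1) :=
        mul_nonneg (mul_nonneg (hwp i) (mul_self_nonneg _)) (sub_nonneg.2 h1)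
      nlinarith
    have hgain : ∑ e, x e * (K * (I.w e * I.p e)) = K * I.lpValue x := by
      unfold lpValue
      rw [Finset.mul_sum]
      exact Finset.sum_congr rfl fun e _ => by ring
    have hsum := Finset.sum_le_sum fun e (_ : e ∈ Finset.univ) => hprobe e
    simp_rw [mul_add, mul_sub] at hsum
    rw [Finset.sum_add_distrib, Finset.sum_add_distrib, Finset.sum_add_distrib,
      Finset.sum_sub_distrib, ← Finset.sum_mul, hgain] at hsum
    have hdiv : ∀ V : E → ℝ,
        (∑ i, x i) * (K * ∑ e, x e / (∑ i, x i) * V e) = ∑ e, x e * (K * V e) := by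
      intro V
      rw [Finset.mul_sum, Finset.mul_sum]
      exact Finset.sum_congr rfl fun e _ => by field_simp
    have hKx : K * I.lpValue x = kin * I.lpValue x + kout * I.lpValue x := by rw [hK]; ring
    rw [lpValue_random, ← mul_le_mul_iff_right₀ hX, hdiv]
    linarith

end ProbingInstance

end StochasticProbing

theorem theorem2 {E : Type*} [Fintype E] [DecidableEq E] {kin kout : ℕ} (hkout : 1 ≤ kout)
    (I : StochasticProbing.ProbingInstance E kin kout) :
    (∃ x, I.IsLPOptimal x) ∧
    ∀ x, I.IsLPOptimal x →
      (∃ π, I.IterativeRounding x ∅ ∅ π) ∧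
      ∀ π, I.IterativeRounding x ∅ ∅ π →
        I.IsPolicy π ∧
        ∀ σ, I.IsPolicy σ →
          1 / ((kin : ℝ) + (kout : ℝ)) * I.expectedWeight σ ≤ I.expectedWeight π := by
  refine ⟨StochasticProbing.exists_isLPOptimal I, fun x hx => ⟨?_, fun π hπ => ?_⟩⟩
  · refine StochasticProbing.exists_iterativeRounding I _ x ∅ ∅ rfl
      ⟨fun e => (hx.1.1 e).1, fun j => ?_, fun j => ?_⟩
    · simpa using hx.1.2.1 j
    · simpa using hx.1.2.2 j
  · have hpol : I.IsPolicy π := hπ.feasible hkout (by simp) (by simp)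
    refine ⟨hpol, fun σ hσ => ?_⟩
    have hpos : 0 < (kin : ℝ) + kout := by
      have : (1 : ℝ) ≤ kout := by exact_mod_cast hkout
      positivity
    rw [one_div, inv_mul_le_iff₀ hpos, I.expectedWeight_eq hpol]
    exact (hx.expectedWeight_le hσ).trans (hπ.lpValue_le hkout)
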